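/- Let $p$ be an odd prime and let $\varepsilon$ be a non-square modulo $p$. Let $B$ be an indefinite quaternion algebra over $\mathbb{Q}$, let $R\subset B$ be an order of (reduced) discriminant $M$, and fix identifications $B\otimes\mathbb{R}=M_2(\mathbb{R})$ and $R\otimes\mathbb{Z}_p=M_2(\mathbb{Z}_p)$ (so $p\nmid M$); put $N=p^2M$. For $x\in R$ let $x_p\in M_2(\mathbb{Z}_p)$ be its image. Let $M_{ns+}$ be the set of all $\begin{pmatrix}a&b\\c&d\end{pmatrix}\in M_2(\mathbb{Z}_p)$ with ($a\equiv d$ and $b\varepsilon\equiv c$) or ($a\equiv -d$ and $-b\varepsilon\equiv c$) modulo $p$, and let $M_{s+}$ be the set of those with $b\equiv c\equiv 0$ or $a\equiv d\equiv 0$ modulo $p$. For $?\in\{ns+,s+\}$ put $R_?=\{x\in R: x_p\in M_?\}$, let $\Gamma_?$ be the group of elements of reduced norm $1$ in $R_?$, let $X_?$ be the compactification of $\Gamma_?\backslash\mathcal{H}$ (by cusps, if there are any), and let $J_?=S_2(\Gamma_?)^\vee/H_1(X_?,\mathbb{Z})$ be its Jacobian. A set $S\subset B^\times$ of elements of positive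 reduced norm that is left stable under $\Gamma$, right stable under $\Gamma'$ and a finite union of cosets $\Gamma\alpha$ induces a homomorphism $\mathrm{Jac}(\Gamma')\to\mathrm{Jac}(\Gamma)$ through the correspondence $[z]\mapsto\sum_{\Gamma\alpha\subset S}[\alpha z]$. For a prime $\ell\nmid N$ the Hecke operator $T_\ell$ on $J_?$ is the one given by $S=\{\alpha\in R_?:\mathrm{nrd}(\alpha)=\ell\}$. Let $J_{s+}^{p\text{-new}}$ be the quotient of $J_{s+}$ by its $p$-old part, which is generated by the images of the maps $\Gamma_{s+}\cdot 1\cdot\Gamma'$ from $\mathrm{Jac}(\Gamma')$, where $\Gamma'$ is the group of all $x\in R$ of reduced norm $1$ with $x_p$ upper triangular modulo $p$, or the one with $x_p$ lower triangular modulo $p$. Then, for every prime $\ell$ not dividing $N$, the map $J_{ns+}\to J_{s+}$ given by the double coset $\Gamma_{s+}\cdot 1\cdot\Gamma_{ns+}$ commutes with $T_\ell$. Moreover, $T_\ell$ maps the $p$-old part of $J_{s+}$ to itself, hence acts on $J_{s+}^{p\text{-new}}$, and the induced map $\Gamma_{s+}\cdot 1\cdot\Gamma_{ns+}\colon J_{ns+}\to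 J_{s+}^{p\text{-new}}$ commutes with $T_\ell$. -/

import Mathlib

open scoped ModularForm MatrixGroups

noncomputable section

/-! ### Hecke correspondences between Fuchsian groups -/

/-- A finite union `S` of double cosets `Γ α Γ'` with `det α > 0`: a set of matrices of positive
determinant, stable under left multiplication by `Γ` and right multiplication by `Γ'`, and
consisting of finitely many cosets `Γ α`. It defines the correspondence
`[z] ↦ ∑_{Γ α ⊆ S} [α z]` from `Γ' \ ℋ` to `Γ \ ℋ`. -/
structure HeckeCorrespondence (Γ Γ' : Subgroup (GL (Fin 2) ℝ)) where
  carrier : Set (GL (Fin 2) ℝ)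
  det_pos : ∀ α ∈ carrier, 0 < α.det.val
  mul_mem_left : ∀ γ ∈ Γ, ∀ α ∈ carrier, γ * α ∈ carrier
  mul_mem_right : ∀ γ ∈ Γ', ∀ α ∈ carrier, α * γ ∈ carrier
  finite_cosets : ∃ s : Finset (GL (Fin 2) ℝ), ∀ α ∈ carrier, ∃ γ ∈ Γ, γ * α ∈ s

namespace HeckeCorrespondence

variable {Γ Γ' : Subgroup (GL (Fin 2) ℝ)} (S : HeckeCorrespondence Γ Γ')

/-- Two elements are equivalent if they lie in the same coset `Γ α`. -/
def cosetSetoid : Setoid S.carrier where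
  r α β := ∃ γ ∈ Γ, γ * α.1 = β.1
  iseqv :=
    { refl := fun α => ⟨1, Γ.one_mem, one_mul _⟩
      symm := by
        rintro α β ⟨γ, hγ, h⟩
        exact ⟨γ⁻¹, Γ.inv_mem hγ, by rw [← h, inv_mul_cancel_left]⟩
      trans := by
        rintro α β δ ⟨γ, hγ, h⟩ ⟨γ', hγ', h'⟩
        exact ⟨γ' * γ, Γ.mul_mem hγ' hγ, by rw [mul_assoc, h, h']⟩ }

/-- The set `Γ \ S` of cosets `Γ α` contained in `S`. -/
def Cosets : Type := Quotient S.cosetSetoid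

instance : Finite S.Cosets := by
  obtain ⟨s, hs⟩ := S.finite_cosets
  have hs' : ∀ q : S.Cosets, ∃ β : s, ∃ γ ∈ Γ, γ * (Quotient.out q).1 = β.1 := by
    intro q
    obtain ⟨γ, hγ, h⟩ := hs _ (Quotient.out q).2
    exact ⟨⟨_, h⟩, γ, hγ, rfl⟩
  choose F γ hγ hF using hs'
  refine Finite.of_injective F fun q q' h => ?_
  rw [← Quotient.out_eq q, ← Quotient.out_eq q']
  refine Quotient.sound ⟨(γ q')⁻¹ * γ q, Γ.mul_mem (Γ.inv_mem (hγ q')) (hγ q), ?_⟩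
  rw [mul_assoc, hF, h, ← hF, inv_mul_cancel_left]

instance : Fintype S.Cosets := Fintype.ofFinite _

/-- The permutation of `Γ \ S` given by right multiplication with `γ ∈ Γ'`. -/
def rightMul {γ : GL (Fin 2) ℝ} (hγ : γ ∈ Γ') : S.Cosets ≃ S.Cosets where
  toFun := Quotient.map (fun α => ⟨α.1 * γ, S.mul_mem_right γ hγ _ α.2⟩) (by
    rintro α β ⟨δ, hδ, h⟩
    exact ⟨δ, hδ, by simp only [← mul_assoc, h]⟩)
  invFun := Quotient.map (fun α => ⟨α.1 * γ⁻¹, S.mul_mem_right _ (Γ'.inv_mem hγ) _ α.2⟩) (by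
    rintro α β ⟨δ, hδ, h⟩
    exact ⟨δ, hδ, by simp only [← mul_assoc, h]⟩)
  left_inv := by
    rintro ⟨α⟩
    exact congrArg (Quotient.mk S.cosetSetoid) (Subtype.ext (mul_inv_cancel_right _ _))
  right_inv := by
    rintro ⟨α⟩
    exact congrArg (Quotient.mk S.cosetSetoid) (Subtype.ext (inv_mul_cancel_right _ _))

/-- The summand `f ∣[2] α`, which depends only on the coset `Γ α`. -/
def slashTerm (f : CuspForm Γ 2) : S.Cosets → UpperHalfPlane → ℂ :=
  Quotient.lift (fun α => (f : UpperHalfPlane → ℂ) ∣[(2 : ℤ)] α.1) (by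
    rintro α β ⟨γ, hγ, h⟩
    simp only [← h, SlashAction.slash_mul]
    rw [SlashInvariantFormClass.slash_action_eq f γ hγ])

lemma slashTerm_slash (f : CuspForm Γ 2) {γ : GL (Fin 2) ℝ} (hγ : γ ∈ Γ') (q : S.Cosets) :
    S.slashTerm f q ∣[(2 : ℤ)] γ = S.slashTerm f (S.rightMul hγ q) := by
  obtain ⟨α⟩ := q
  exact (SlashAction.slash_mul _ _ _ _).symm

lemma isCusp_smul {c : OnePoint ℝ} (hc : IsCusp c Γ') {α : GL (Fin 2) ℝ} (hα : α ∈ S.carrier) :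
    IsCusp (α • c) Γ := by
  obtain ⟨g, hg, hgp, hgc⟩ := hc
  let F : ℕ → S.Cosets := fun n =>
    Quotient.mk S.cosetSetoid ⟨α * g ^ n, S.mul_mem_right _ (Γ'.pow_mem hg n) _ hα⟩
  obtain ⟨m, n, hmn, h⟩ : ∃ m n, m < n ∧ F m = F n := by
    obtain ⟨m, n, hne, h⟩ := Finite.exists_ne_map_eq_of_infinite F
    rcases lt_or_gt_of_ne hne with h1 | h1
    · exact ⟨m, n, h1, h⟩
    · exact ⟨n, m, h1, h.symm⟩
  obtain ⟨γ, hγ, h⟩ : ∃ γ ∈ Γ, γ * (α * g ^ m) = α * g ^ n := Quotient.exact h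
  obtain ⟨k, hk, rfl⟩ : ∃ k, k ≠ 0 ∧ n = k + m := ⟨n - m, by omega, by omega⟩
  have hγ' : γ = α * g ^ k * α⁻¹ := by
    rw [pow_add] at h
    have : γ * α = α * g ^ k := by
      apply mul_right_cancel (b := g ^ m)
      simpa [mul_assoc] using h
    rw [← this, mul_inv_cancel_right]
  refine ⟨γ, hγ, ?_, ?_⟩
  · rw [hγ']
    simpa using hgp.pow hk
  · have hk' : g ^ k • c = c := by
      rwa [(hgp.pow hk).smul_eq_self_iff, hgp.parabolicFixedPoint_pow hk, ← hgp.smul_eq_self_iff]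
    rw [hγ', mul_smul, inv_smul_smul, mul_smul, hk']

/-- The Hecke operator `f ↦ ∑_{Γ α ⊆ S} f ∣[2] α` from `S₂(Γ)` to `S₂(Γ')`. -/
def onForms (f : CuspForm Γ 2) : CuspForm Γ' 2 where
  toFun := ∑ q : S.Cosets, S.slashTerm f q
  slash_action_eq' γ hγ := by
    rw [SlashAction.sum_slash]
    simp only [S.slashTerm_slash f hγ]
    exact Equiv.sum_comp (S.rightMul hγ) (S.slashTerm f)
  holo' := by
    refine .sum fun q _ => ?_
    obtain ⟨α⟩ := q
    exact f.holo'.slash _ _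
  zero_at_cusps' := by
    intro c hc g hg
    change UpperHalfPlane.IsZeroAtImInfty ((∑ q : S.Cosets, S.slashTerm f q) ∣[(2 : ℤ)] g)
    rw [SlashAction.sum_slash, UpperHalfPlane.IsZeroAtImInfty, Filter.ZeroAtFilter,
      Finset.sum_fn, show (0 : ℂ) = ∑ q : S.Cosets, 0 by simp]
    refine tendsto_finsetSum _ fun q _ => ?_
    obtain ⟨α⟩ := q
    exact OnePoint.IsZeroAt.smul_iff.mp (f.zero_at_cusps' (S.isCusp_smul hc α.2)) g hg

lemma onForms_apply (f : CuspForm Γ 2) (z : UpperHalfPlane) :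
    S.onForms f z = ∑ q : S.Cosets, S.slashTerm f q z := by
  change (∑ q : S.Cosets, S.slashTerm f q) z = _
  simp

/-- The Hecke operator as a `ℂ`-linear map. -/
def onFormsLinear [Γ.HasDetOne] [Γ'.HasDetOne] : CuspForm Γ 2 →ₗ[ℂ] CuspForm Γ' 2 where
  toFun := S.onForms
  map_add' f g := by
    ext z
    simp only [onForms_apply, add_apply, ← Finset.sum_add_distrib]
    refine Finset.sum_congr rfl fun q _ => ?_
    obtain ⟨α⟩ := q
    change (((f + g : CuspForm Γ 2) : UpperHalfPlane → ℂ) ∣[(2 : ℤ)] α.1) z =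
      ((f : UpperHalfPlane → ℂ) ∣[(2 : ℤ)] α.1) z + ((g : UpperHalfPlane → ℂ) ∣[(2 : ℤ)] α.1) z
    rw [FunLike.coe_add, SlashAction.add_slash, Pi.add_apply]
  map_smul' c f := by
    ext z
    simp only [onForms_apply, smul_apply, RingHom.id_apply, Finset.smul_sum]
    refine Finset.sum_congr rfl fun q _ => ?_
    obtain ⟨α⟩ := q
    have hα := S.det_pos _ α.2
    change (((c • f : CuspForm Γ 2) : UpperHalfPlane → ℂ) ∣[(2 : ℤ)] α.1) z =
      c • ((f : UpperHalfPlane → ℂ) ∣[(2 : ℤ)] α.1) z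
    rw [FunLike.coe_smul, ModularForm.smul_slash, UpperHalfPlane.σ, if_pos hα]
    rfl

end HeckeCorrespondence

/-! ### The Jacobian as a complex torus -/

/-- The integral of `f(z) dz` along the segment from `z` to `w` in the upper half plane. -/
def segmentIntegral (f : UpperHalfPlane → ℂ) (z w : UpperHalfPlane) : ℂ :=
  ∫ t in (0 : ℝ)..1, ((w : ℂ) - z) * f (UpperHalfPlane.ofComplex ((z : ℂ) + t * ((w : ℂ) - z)))

lemma segment_im_pos (z w : UpperHalfPlane) {t : ℝ} (ht : t ∈ Set.Icc (0 : ℝ) 1) :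
    0 < ((z : ℂ) + t * ((w : ℂ) - z)).im := by
  have hz := z.im_pos
  have hw := w.im_pos
  have h : ((z : ℂ) + t * ((w : ℂ) - z)).im = (1 - t) * z.im + t * w.im := by
    simp; ring
  rw [h]
  rcases eq_or_lt_of_le ht.1 with h0 | h0
  · rw [← h0]; simpa using hz
  · have := mul_pos h0 hw
    have := mul_nonneg (sub_nonneg.2 ht.2) hz.le
    linarith

lemma exists_primitive {Γ : Subgroup (GL (Fin 2) ℝ)} (f : CuspForm Γ 2) :
    ∃ F : ℂ → ℂ, ∀ z : UpperHalfPlane, HasDerivAt F (f z) z := by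
  obtain ⟨F, hF⟩ := Convex.exists_forall_hasDerivWithinAt (𝕜 := ℂ)
    (convex_halfSpace_im_gt 0) (UpperHalfPlane.mdifferentiable_iff.mp f.holo')
  refine ⟨F, fun z => ?_⟩
  have h := (hF z z.im_pos).hasDerivAt
    (UpperHalfPlane.isOpen_upperHalfPlaneSet.mem_nhds z.im_pos)
  simpa using! h

lemma continuousOn_segmentIntegrand {f : UpperHalfPlane → ℂ} (hf : Continuous f)
    (z w : UpperHalfPlane) :
    ContinuousOn (fun t : ℝ => ((w : ℂ) - z) *
      f (UpperHalfPlane.ofComplex ((z : ℂ) + t * ((w : ℂ) - z)))) (Set.uIcc 0 1) := by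
  rw [Set.uIcc_of_le zero_le_one]
  intro t ht
  refine ContinuousAt.continuousWithinAt (continuousAt_const.mul ?_)
  refine ContinuousAt.comp (f := fun t : ℝ =>
    UpperHalfPlane.ofComplex ((z : ℂ) + t * ((w : ℂ) - z))) hf.continuousAt ?_
  refine ContinuousAt.comp (f := fun t : ℝ => (z : ℂ) + t * ((w : ℂ) - z)) (g := UpperHalfPlane.ofComplex)
    (UpperHalfPlane.contMDiffAt_ofComplex (n := 0) (segment_im_pos z w ht)).continuousAt ?_
  fun_prop

lemma segmentIntegral_eq_sub {f : UpperHalfPlane → ℂ} (hf : Continuous f) {F : ℂ → ℂ}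
    (hF : ∀ z : UpperHalfPlane, HasDerivAt F (f z) z) (z w : UpperHalfPlane) :
    segmentIntegral f z w = F w - F z := by
  have key := intervalIntegral.integral_eq_sub_of_hasDerivAt
    (f := fun t : ℝ => F ((z : ℂ) + t * ((w : ℂ) - z)))
    (f' := fun t : ℝ => ((w : ℂ) - z) *
      f (UpperHalfPlane.ofComplex ((z : ℂ) + t * ((w : ℂ) - z)))) (a := 0) (b := 1) ?_
      (continuousOn_segmentIntegrand hf z w).intervalIntegrable
  · rw [segmentIntegral, key]
    simp
  · intro t ht
    rw [Set.uIcc_of_le zero_le_one] at ht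
    have him := segment_im_pos z w ht
    have h1 := hF ⟨_, him⟩
    have h2 : HasDerivAt (fun t : ℝ => (z : ℂ) + t * ((w : ℂ) - z)) ((w : ℂ) - z) t := by
      simpa using ((Complex.ofRealCLM.hasDerivAt (x := t)).mul_const ((w : ℂ) - z)).const_add (z : ℂ)
    have h3 := HasDerivAt.comp t h1 h2
    rw [UpperHalfPlane.ofComplex_apply_of_im_pos him, mul_comm]
    exact h3

section Jacobian

variable (Γ : Subgroup (GL (Fin 2) ℝ)) [Γ.HasDetOne]

/-- The functional `f ↦ ∫_z^w f(u) du` on `S₂(Γ)`. -/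
def integralFunctional (z w : UpperHalfPlane) : Module.Dual ℂ (CuspForm Γ 2) where
  toFun f := segmentIntegral f z w
  map_add' f g := by
    simp only [segmentIntegral, add_apply, mul_add]
    exact intervalIntegral.integral_add
      (continuousOn_segmentIntegrand (ModularFormClass.continuous f) z w).intervalIntegrable
      (continuousOn_segmentIntegrand (ModularFormClass.continuous g) z w).intervalIntegrable
  map_smul' c f := by
    simp only [segmentIntegral, smul_apply, smul_eq_mul, mul_left_comm _ c, RingHom.id_apply]
    exact intervalIntegral.integral_const_mul c _

/-- The image of `H₁(X, ℤ)` in `S₂(Γ)^∨`, where `X` is the compactification of `Γ \ ℋ`: it is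
generated by the integrals along the closed paths of `X` that are images of paths in the upper
half plane from `z` to `γ z`, with `γ ∈ Γ`. -/
def periodLattice : AddSubgroup (Module.Dual ℂ (CuspForm Γ 2)) :=
  AddSubgroup.closure {φ | ∃ γ ∈ Γ, ∃ z : UpperHalfPlane, φ = integralFunctional Γ z (γ • z)}

/-- The group of complex points of the Jacobian of the compactification `X` of `Γ \ ℋ`, as the
complex torus `H⁰(X, Ω¹)^∨ / H₁(X, ℤ) = S₂(Γ)^∨ / (period lattice)`. If `Γ` has no
parabolic elements, there are no cusps, and `CuspForm Γ 2` consists of all `Γ`-invariant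
holomorphic differentials. -/
def Jacobian : Type := Module.Dual ℂ (CuspForm Γ 2) ⧸ periodLattice Γ

instance : AddCommGroup (Jacobian Γ) :=
  inferInstanceAs (AddCommGroup (Module.Dual ℂ (CuspForm Γ 2) ⧸ periodLattice Γ))

end Jacobian

namespace HeckeCorrespondence

variable {Γ Γ' : Subgroup (GL (Fin 2) ℝ)}

lemma segmentIntegral_slash {f : CuspForm Γ 2} {F : ℂ → ℂ}
    (hF : ∀ z : UpperHalfPlane, HasDerivAt F (f z) z) {α : GL (Fin 2) ℝ} (hα : 0 < α.det.val)
    (z w : UpperHalfPlane) :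
    segmentIntegral ((f : UpperHalfPlane → ℂ) ∣[(2 : ℤ)] α) z w =
      F ((α • w : UpperHalfPlane) : ℂ) - F ((α • z : UpperHalfPlane) : ℂ) := by
  have hc : Continuous ((f : UpperHalfPlane → ℂ) ∣[(2 : ℤ)] α) :=
    (f.holo'.slash 2 α).continuous
  rw [segmentIntegral_eq_sub hc (F := fun u =>
    F ((α • UpperHalfPlane.ofComplex u : UpperHalfPlane) : ℂ))]
  · simp
  · intro u
    have h1 := (UpperHalfPlane.hasStrictDerivAt_smul (g := α) hα u).hasDerivAt
    have h2 := HasDerivAt.comp (h₂ := F) (u : ℂ) (by simpa using hF (α • u)) h1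
    convert! h2 using 1
    rw [ModularForm.slash_apply, UpperHalfPlane.σ, if_pos hα, abs_of_pos hα]
    simp
    ring

variable [Γ.HasDetOne] [Γ'.HasDetOne] (S : HeckeCorrespondence Γ Γ')

lemma periodLattice_le_comap :
    periodLattice Γ' ≤ (periodLattice Γ).comap S.onFormsLinear.dualMap.toAddMonoidHom := by
  rw [periodLattice, AddSubgroup.closure_le]
  rintro _ ⟨γ, hγ, z, rfl⟩
  choose g hg hgq using fun q : S.Cosets =>
    (Quotient.exact ((Quotient.out_eq (S.rightMul hγ q)).trans
      (congrArg (S.rightMul hγ) (Quotient.out_eq q).symm)) :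
      ∃ δ ∈ Γ, δ * (Quotient.out (S.rightMul hγ q)).1 = (Quotient.out q).1 * γ)
  have key : S.onFormsLinear.dualMap (integralFunctional Γ' z (γ • z)) =
      ∑ q : S.Cosets, integralFunctional Γ ((Quotient.out (S.rightMul hγ q)).1 • z)
        (g q • (Quotient.out (S.rightMul hγ q)).1 • z) := by
    ext f
    obtain ⟨F, hF⟩ := exists_primitive f
    have hc := ModularFormClass.continuous f
    rw [LinearMap.sum_apply]
    change segmentIntegral (S.onForms f) z (γ • z) = ∑ q : S.Cosets, segmentIntegral f _ _
    simp only [segmentIntegral_eq_sub hc hF, smul_smul, hgq]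
    have h1 : segmentIntegral (S.onForms f) z (γ • z) =
        ∑ q : S.Cosets, segmentIntegral (S.slashTerm f q) z (γ • z) := by
      simp only [segmentIntegral, onForms_apply, Finset.mul_sum]
      refine intervalIntegral.integral_finsetSum fun q _ => ?_
      refine (continuousOn_segmentIntegrand ?_ z (γ • z)).intervalIntegrable
      obtain ⟨α⟩ := q
      exact (f.holo'.slash 2 α.1).continuous
    have h2 : ∀ q : S.Cosets, segmentIntegral (S.slashTerm f q) z (γ • z) =
        F (((Quotient.out q).1 • γ • z : UpperHalfPlane) : ℂ) -
          F (((Quotient.out q).1 • z : UpperHalfPlane) : ℂ) := by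
      intro q
      rw [← segmentIntegral_slash hF (S.det_pos _ (Quotient.out q).2)]
      congr 1
      conv_lhs => rw [← Quotient.out_eq q]
      rfl
    rw [h1]
    simp only [h2, Finset.sum_sub_distrib, smul_smul]
    congr 1
    exact (Equiv.sum_comp (S.rightMul hγ) fun q : S.Cosets =>
      F (((Quotient.out q).1 • z : UpperHalfPlane) : ℂ)).symm
  change S.onFormsLinear.dualMap (integralFunctional Γ' z (γ • z)) ∈ periodLattice Γ
  rw [key]
  exact AddSubgroup.sum_mem _ fun q _ => AddSubgroup.subset_closure ⟨g q, hg q, _, rfl⟩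

/-- The homomorphism `Jac(Γ') → Jac(Γ)` defined by the correspondence `[z] ↦ ∑_{Γ α ⊆ S} [α z]`
from `Γ' \ ℋ` to `Γ \ ℋ`. On the complex tori it is induced by the transpose of the operator
`f ↦ ∑_{Γ α ⊆ S} f ∣[2] α` from `S₂(Γ)` to `S₂(Γ')`. -/
def onJacobian : Jacobian Γ' →+ Jacobian Γ :=
  QuotientAddGroup.map _ _ S.onFormsLinear.dualMap.toAddMonoidHom S.periodLattice_le_comap

end HeckeCorrespondence

/-! ### Cartan groups -/

/-- The reductions modulo `p` of the matrices in `M_{ns+}`: a matrix over `ℤ_p` lies in `M_{ns+}`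
if and only if its reduction lies in this set. -/
def cartanNsPlus (p : ℕ) [Fact p.Prime] (ε : ZMod p) :
    Submonoid (Matrix (Fin 2) (Fin 2) (ZMod p)) where
  carrier := {A | (A 0 0 = A 1 1 ∧ A 0 1 * ε = A 1 0) ∨ (A 0 0 = -A 1 1 ∧ -(A 0 1 * ε) = A 1 0)}
  one_mem' := by simp
  mul_mem' := by
    rintro A B hA hB
    simp only [Set.mem_ofPred_eq, Matrix.mul_apply, Fin.sum_univ_two] at *
    rcases hA with ⟨h1, h2⟩ | ⟨h1, h2⟩ <;> rcases hB with ⟨h3, h4⟩ | ⟨h3, h4⟩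
    · left; rw [h1, ← h2, h3, ← h4]; constructor <;> ring
    · right; rw [h1, ← h2, h3, ← h4]; constructor <;> ring
    · right; rw [h1, ← h2, h3, ← h4]; constructor <;> ring
    · left; rw [h1, ← h2, h3, ← h4]; constructor <;> ring

/-- The reductions modulo `p` of the matrices in `M_{s+}`: the diagonal and the antidiagonal
matrices. A matrix over `ℤ_p` lies in `M_{s+}` if and only if its reduction lies in this set. -/
def cartanSPlus (p : ℕ) [Fact p.Prime] : Submonoid (Matrix (Fin 2) (Fin 2) (ZMod p)) where
  carrier := {A | (A 0 1 = 0 ∧ A 1 0 = 0) ∨ (A 0 0 = 0 ∧ A 1 1 = 0)}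
  one_mem' := by simp
  mul_mem' := by
    rintro A B hA hB
    simp only [Set.mem_ofPred_eq, Matrix.mul_apply, Fin.sum_univ_two] at *
    rcases hA with ⟨h1, h2⟩ | ⟨h1, h2⟩ <;> rcases hB with ⟨h3, h4⟩ | ⟨h3, h4⟩ <;>
      simp [h1, h2, h3, h4]

/-- The upper triangular matrices. -/
def upperTriangular (p : ℕ) [Fact p.Prime] : Submonoid (Matrix (Fin 2) (Fin 2) (ZMod p)) where
  carrier := {A | A 1 0 = 0}
  one_mem' := by simp
  mul_mem' := by
    rintro A B (hA : A 1 0 = 0) (hB : B 1 0 = 0)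
    simp [Matrix.mul_apply, Fin.sum_univ_two, hA, hB]

/-- The lower triangular matrices. -/
def lowerTriangular (p : ℕ) [Fact p.Prime] : Submonoid (Matrix (Fin 2) (Fin 2) (ZMod p)) where
  carrier := {A | A 0 1 = 0}
  one_mem' := by simp
  mul_mem' := by
    rintro A B (hA : A 0 1 = 0) (hB : B 0 1 = 0)
    simp [Matrix.mul_apply, Fin.sum_univ_two, hA, hB]


/-! ### Quaternion algebras, orders and the groups of level `p` -/

/-- An indefinite quaternion algebra `B = (a, b)_ℚ`, an order `R` of `B`, an identification
of `B ⊗ ℝ` with `M₂(ℝ)` and an identification of `R ⊗ ℤ_p` with `M₂(ℤ_p)`. -/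
structure ShimuraDatum (p : ℕ) [Fact p.Prime] where
  /-- the quaternion algebra has the basis `1, i, j, i j` with `i ^ 2 = a`, `j ^ 2 = b`,
  `j i = - i j` -/
  a : ℚ
  b : ℚ
  a_ne_zero : a ≠ 0
  b_ne_zero : b ≠ 0
  /-- the order: a subring that is a lattice -/
  R : Subring (QuaternionAlgebra ℚ a 0 b)
  finite_R : Module.Finite ℤ R
  span_R : Submodule.span ℚ (R : Set (QuaternionAlgebra ℚ a 0 b)) = ⊤
  /-- the identification of `B ⊗ ℝ` with `M₂(ℝ)`: as both are simple of dimension `4`, it is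
  determined by any homomorphism from `B` -/
  ιinf : QuaternionAlgebra ℚ a 0 b →ₐ[ℚ] Matrix (Fin 2) (Fin 2) ℝ
  /-- the identification `x ↦ x_p` of `R ⊗ ℤ_p` with `M₂(ℤ_p)`: as both are free of rank `4`, it
  is determined by a homomorphism from `R` whose image spans `M₂(ℤ_p)` -/
  ιp : R →+* Matrix (Fin 2) (Fin 2) ℤ_[p]
  span_ιp : Submodule.span ℤ_[p] (Set.range ιp) = ⊤

namespace ShimuraDatum

variable {p : ℕ} [Fact p.Prime] (D : ShimuraDatum p)

/-- The quaternion algebra. -/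
abbrev B : Type := QuaternionAlgebra ℚ D.a 0 D.b

/-- The reduced norm. -/
def nrd (x : D.B) : ℚ := (x * star x).re

/-- The reduced trace. -/
def trd (x : D.B) : ℚ := (x + star x).re

/-- `R` has (reduced) discriminant `M`: `|det (trd (e_i e_j))| = M ^ 2` for a `ℤ`-basis `e`. -/
def HasReducedDiscriminant (M : ℕ) : Prop :=
  ∃ e : Module.Basis (Fin 4) ℤ D.R,
    |(Matrix.of fun i j => D.trd ((e i : D.B) * (e j : D.B))).det| = (M : ℚ) ^ 2

lemma mul_star_eq (x : D.B) : x * star x = algebraMap ℚ D.B (D.nrd x) :=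
  QuaternionAlgebra.mul_star_eq_coe x

lemma star_mul_eq (x : D.B) : star x * x = algebraMap ℚ D.B (D.nrd x) := by
  have h : (star x * x).re = (x * star x).re := by simp
  exact (QuaternionAlgebra.star_mul_eq_coe x).trans (congrArg (algebraMap ℚ D.B) h)

lemma nrd_mul (x y : D.B) : D.nrd (x * y) = D.nrd x * D.nrd y := by
  simp [nrd]; ring

lemma nrd_one : D.nrd 1 = 1 := by simp [nrd]

lemma trace_ιinf (x : D.B) : (D.ιinf x).trace = 2 * x.re := by
  have ha : (D.a : ℝ) ≠ 0 := by exact_mod_cast D.a_ne_zero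
  have hb : (D.b : ℝ) ≠ 0 := by exact_mod_cast D.b_ne_zero
  let i : D.B := ⟨0, 1, 0, 0⟩
  let j : D.B := ⟨0, 0, 1, 0⟩
  have hii : D.ιinf i * D.ιinf i = algebraMap ℚ _ D.a := by
    rw [← map_mul, ← D.ιinf.commutes]
    congr 1
    ext <;> simp [i, QuaternionAlgebra.algebraMap_eq]
  have hjj : D.ιinf j * D.ιinf j = algebraMap ℚ _ D.b := by
    rw [← map_mul, ← D.ιinf.commutes]
    congr 1
    ext <;> simp [j, QuaternionAlgebra.algebraMap_eq]
  have hji : D.ιinf j * D.ιinf i = - (D.ιinf i * D.ιinf j) := by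
    rw [← map_mul, ← map_mul, ← map_neg]
    congr 1
    ext <;> simp [i, j]
  have hx : x = algebraMap ℚ D.B x.re + x.imI • i + x.imJ • j + x.imK • (i * j) := by
    ext <;> simp [i, j, QuaternionAlgebra.algebraMap_eq]
  have tr_smul : ∀ (q : ℚ) (A : Matrix (Fin 2) (Fin 2) ℝ), (q • A).trace = q * A.trace := by
    intro q A
    rw [Matrix.trace_smul, Rat.smul_def]
  have tr_alg : ∀ q : ℚ, (algebraMap ℚ (Matrix (Fin 2) (Fin 2) ℝ) q).trace = 2 * q := by
    intro q
    rw [Algebra.algebraMap_eq_smul_one, tr_smul, Matrix.trace_one]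
    simp [mul_comm]
  have alg_mul : ∀ (q : ℚ) (A : Matrix (Fin 2) (Fin 2) ℝ),
      (algebraMap ℚ (Matrix (Fin 2) (Fin 2) ℝ) q * A).trace = q * A.trace := by
    intro q A
    rw [← Algebra.smul_def, tr_smul]
  have hi : (D.ιinf i).trace = 0 := by
    have h1 : (D.ιinf j * D.ιinf i * D.ιinf j).trace = D.b * (D.ιinf i).trace := by
      rw [Matrix.trace_mul_comm, ← mul_assoc, hjj, alg_mul]
    have h2 : (D.ιinf j * D.ιinf i * D.ιinf j).trace = -(D.b * (D.ιinf i).trace) := by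
      rw [hji, neg_mul, mul_assoc, hjj, Matrix.trace_neg, Matrix.trace_mul_comm, alg_mul]
    have : D.b * (D.ιinf i).trace = 0 := by linarith
    exact (mul_eq_zero.1 this).resolve_left hb
  have hj : (D.ιinf j).trace = 0 := by
    have h1 : (D.ιinf i * (D.ιinf j * D.ιinf i)).trace = D.a * (D.ιinf j).trace := by
      rw [Matrix.trace_mul_comm, mul_assoc, hii, Matrix.trace_mul_comm, alg_mul]
    have h2 : (D.ιinf i * (D.ιinf j * D.ιinf i)).trace = -(D.a * (D.ιinf j).trace) := by
      rw [hji, mul_neg, ← mul_assoc, hii, Matrix.trace_neg, alg_mul]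
    have : D.a * (D.ιinf j).trace = 0 := by linarith
    exact (mul_eq_zero.1 this).resolve_left ha
  have hk : (D.ιinf (i * j)).trace = 0 := by
    have h1 : (D.ιinf i * D.ιinf j).trace = -(D.ιinf i * D.ιinf j).trace := by
      rw [← Matrix.trace_neg, ← hji, Matrix.trace_mul_comm]
    rw [map_mul]
    linarith
  conv_lhs => rw [hx]
  simp only [map_add, map_smul, AlgHom.commutes, Matrix.trace_add, tr_smul, hi, hj, hk, tr_alg]
  ring

lemma det_ιinf (x : D.B) : (D.ιinf x).det = D.nrd x := by
  have h1 : D.ιinf (star x) = (D.ιinf x).adjugate := by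
    have hs : star x = algebraMap ℚ D.B (2 * x.re) - x := by
      ext <;> simp [QuaternionAlgebra.algebraMap_eq]; ring
    have ht := D.trace_ιinf x
    rw [Matrix.trace_fin_two] at ht
    rw [hs, map_sub, AlgHom.commutes, Matrix.adjugate_fin_two]
    ext i j
    fin_cases i <;> fin_cases j <;>
      simp [-map_mul, Matrix.algebraMap_matrix_apply] <;> linarith
  have h2 : D.ιinf x * (D.ιinf x).adjugate = algebraMap ℚ _ (D.nrd x) := by
    rw [← h1, ← map_mul, mul_star_eq, AlgHom.commutes]
  rw [Matrix.mul_adjugate] at h2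
  have := congrFun (congrFun h2 0) 0
  simpa [Matrix.algebraMap_matrix_apply] using this

lemma exists_int_trace {x : D.B} (hx : x ∈ D.R) : ∃ t : ℤ, 2 * x.re = t := by
  have := D.finite_R
  obtain ⟨P, hP, hPx⟩ := IsIntegral.of_finite ℤ (⟨x, hx⟩ : D.R)
  have hPx' : Polynomial.aeval x (P.map (algebraMap ℤ ℚ)) = 0 := by
    rw [Polynomial.aeval_map_algebraMap]
    have h := congrArg D.R.subtype hPx
    rw [map_zero, Polynomial.hom_eval₂] at h
    rw [Polynomial.aeval_def, ← h]
    congr 1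
  by_cases hs : x = algebraMap ℚ D.B x.re
  · rw [hs, Polynomial.aeval_algebraMap_apply] at hPx'
    have h0 : Polynomial.aeval x.re P = 0 := by
      have := (FaithfulSMul.algebraMap_injective ℚ D.B) (hPx'.trans (map_zero _).symm)
      simpa [Polynomial.aeval_def, Polynomial.eval_map] using this
    obtain ⟨n, hn⟩ := isInteger_of_is_root_of_monic hP h0
    refine ⟨2 * n, ?_⟩
    rw [← hn]; simp
  · let Q : Polynomial ℚ := Polynomial.X ^ 2 - Polynomial.C (2 * x.re) * Polynomial.X +
      Polynomial.C (D.nrd x)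
    have hQ : Q.Monic := by unfold Q; monicity!
    have hQd : Q.natDegree = 2 := by unfold Q; compute_degree!
    have hQx : Polynomial.aeval x Q = 0 := by
      have h1 : x + star x = algebraMap ℚ D.B (2 * x.re) := by
        ext <;> simp [QuaternionAlgebra.algebraMap_eq]; ring
      simp only [Q, map_add, map_sub, map_mul, map_pow, Polynomial.aeval_X, Polynomial.aeval_C]
      rw [← map_mul, ← h1, ← star_mul_eq]
      noncomm_ring
    have hdvd : Q ∣ P.map (algebraMap ℤ ℚ) := by
      rw [← Polynomial.modByMonic_eq_zero_iff_dvd hQ]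
      set r := P.map (algebraMap ℤ ℚ) %ₘ Q with hr
      have hrd : r.natDegree < 2 := by
        rw [← hQd]
        exact Polynomial.natDegree_modByMonic_lt _ hQ (by
          intro h; rw [h] at hQd; simp at hQd)
      have hrx : Polynomial.aeval x r = 0 := by
        rw [hr, Polynomial.aeval_modByMonic_eq_self_of_root hQx, hPx']
      have hlin : r = Polynomial.C (r.coeff 1) * Polynomial.X + Polynomial.C (r.coeff 0) :=
        Polynomial.eq_X_add_C_of_natDegree_le_one (by omega)
      rw [hlin, map_add, map_mul, Polynomial.aeval_C, Polynomial.aeval_C, Polynomial.aeval_X,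
        ← Algebra.smul_def] at hrx
      have hr1 : r.coeff 1 = 0 := by
        by_contra h
        apply hs
        have hI := congrArg QuaternionAlgebra.imI hrx
        have hJ := congrArg QuaternionAlgebra.imJ hrx
        have hK := congrArg QuaternionAlgebra.imK hrx
        simp [QuaternionAlgebra.algebraMap_eq, h] at hI hJ hK
        ext <;> simp [QuaternionAlgebra.algebraMap_eq, hI, hJ, hK]
      have hr0 : r.coeff 0 = 0 := by
        have hR := congrArg QuaternionAlgebra.re hrx
        simpa [QuaternionAlgebra.algebraMap_eq, hr1] using hR
      rw [hlin, hr1, hr0]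
      simp
    obtain ⟨g, hg⟩ := IsIntegrallyClosed.eq_map_mul_C_of_dvd ℚ hP hdvd
    rw [hQ.leadingCoeff, map_one, mul_one] at hg
    have hc := congrArg (fun q : Polynomial ℚ => q.coeff 1) hg
    refine ⟨-g.coeff 1, ?_⟩
    simp [Q, Polynomial.coeff_C] at hc
    push_cast
    linarith

lemma star_mem {x : D.B} (hx : x ∈ D.R) : star x ∈ D.R := by
  obtain ⟨t, ht⟩ := D.exists_int_trace hx
  have hs : star x = (t : D.B) - x := by
    have : ((t : ℤ) : D.B) = algebraMap ℚ D.B (2 * x.re) := by rw [ht]; simp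
    rw [this]
    ext <;> simp [QuaternionAlgebra.algebraMap_eq]; ring
  rw [hs]
  exact D.R.sub_mem (intCast_mem _ _) hx

/-- The map `x ↦ x_p mod p` from `R` to `M₂(𝔽_p)`. -/
def reduction : D.R →+* Matrix (Fin 2) (Fin 2) (ZMod p) :=
  (PadicInt.toZMod (p := p)).mapMatrix.comp D.ιp

/-- The group of all `x ∈ R` of reduced norm `1` with `x_p mod p ∈ U`, as a subgroup of
`GL₂(ℝ)` of matrices of determinant `1`. -/
def Gamma (U : Submonoid (Matrix (Fin 2) (Fin 2) (ZMod p))) : Subgroup (GL (Fin 2) ℝ) where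
  carrier := {g | ∃ x : D.R, D.nrd x = 1 ∧ D.reduction x ∈ U ∧ D.ιinf x = g.val}
  one_mem' := ⟨1, by simpa using D.nrd_one, by simp, by simp⟩
  mul_mem' := by
    rintro g h ⟨x, hx, hxU, hxg⟩ ⟨y, hy, hyU, hyh⟩
    refine ⟨x * y, ?_, ?_, ?_⟩
    · rw [Subring.coe_mul, nrd_mul, hx, hy, one_mul]
    · rw [map_mul]; exact U.mul_mem hxU hyU
    · rw [Subring.coe_mul, map_mul, hxg, hyh]; rfl
  inv_mem' := by
    rintro g ⟨x, hx, hxU, hxg⟩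
    let y : D.R := ⟨star x.1, D.star_mem x.2⟩
    have hxy : x * y = 1 := Subtype.ext (by
      change x.1 * star x.1 = 1
      rw [mul_star_eq, hx, map_one])
    have hyx : y * x = 1 := Subtype.ext (by
      change star x.1 * x.1 = 1
      rw [star_mul_eq, hx, map_one])
    refine ⟨y, ?_, ?_, ?_⟩
    · have := congrArg (fun z : D.R => D.nrd z) hxy
      simpa [nrd_mul, hx, nrd_one] using this
    · let u : (Matrix (Fin 2) (Fin 2) (ZMod p))ˣ :=
        ⟨D.reduction x, D.reduction y, by rw [← map_mul, hxy, map_one],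
          by rw [← map_mul, hyx, map_one]⟩
      have hpow : D.reduction y = D.reduction x ^ (orderOf u - 1) := by
        have h1 : u⁻¹ = u ^ (orderOf u - 1) := by
          rw [inv_eq_iff_mul_eq_one, ← pow_succ', Nat.sub_add_cancel (orderOf_pos u),
            pow_orderOf_eq_one]
        have := congrArg Units.val h1
        simpa [u] using this
      rw [hpow]
      exact U.pow_mem hxU _
    · have h1 : g.val * D.ιinf y = 1 := by
        rw [← hxg, ← map_mul, ← Subring.coe_mul, hxy]; simp
      have := congrArg (fun A => (g⁻¹).val * A) h1
      simpa [← mul_assoc] using this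

instance (U : Submonoid (Matrix (Fin 2) (Fin 2) (ZMod p))) : (D.Gamma U).HasDetOne where
  det_eq := by
    rintro g ⟨x, hx, -, hxg⟩
    ext
    rw [Matrix.GeneralLinearGroup.val_det_apply, ← hxg, det_ιinf, hx]
    simp

lemma exists_finset_cosets (U : Submonoid (Matrix (Fin 2) (Fin 2) (ZMod p))) {n : ℕ} (hn : 0 < n)
    {S : Set (GL (Fin 2) ℝ)} (hS : ∀ g ∈ S, ∃ x : D.R, D.nrd x = n ∧ D.ιinf x = g.val) :
    ∃ s : Finset (GL (Fin 2) ℝ), ∀ α ∈ S, ∃ γ ∈ D.Gamma U, γ * α ∈ s := by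
  have := D.finite_R
  obtain ⟨k, e, he⟩ := Module.Finite.exists_fin (R := ℤ) (M := D.R)
  have hp : 0 < p := (Fact.out : p.Prime).pos
  have : NeZero (n * p) := ⟨by positivity⟩
  have hc : ∀ x : D.R, ∃ c : Fin k → ℤ, ∑ i, c i • e i = x := fun x =>
    (Submodule.mem_span_range_iff_exists_fun ℤ).1 (he ▸ Submodule.mem_top)
  choose c hc using hc
  choose! X hXn hXg using hS
  let F : GL (Fin 2) ℝ → (Fin k → ZMod (n * p)) := fun g i => (c (X g) i : ZMod (n * p))
  have hfin : (F '' S).Finite := Set.toFinite _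
  obtain ⟨T, hTS, hTfin, hTimg⟩ : ∃ T ⊆ S, T.Finite ∧ F '' T = F '' S := by
    obtain ⟨T, hT, hT'⟩ := Set.exists_subset_bijOn S F
    exact ⟨T, hT, (Set.finite_image_iff hT'.injOn).1 (hT'.image_eq ▸ hfin), hT'.image_eq⟩
  refine ⟨hTfin.toFinset, fun α hα => ?_⟩
  obtain ⟨β, hβT, hβ⟩ : F α ∈ F '' T := hTimg ▸ Set.mem_image_of_mem F hα
  have hβS := hTS hβT
  have hdvd : ∃ r : D.R, X β = X α + ((n * p : ℕ) : D.R) * r := by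
    have h1 : ∀ i, ∃ m : ℤ, c (X β) i = c (X α) i + ((n * p : ℕ) : ℤ) * m := by
      intro i
      have h2 := congrFun hβ i
      have h3 := ((ZMod.intCast_eq_intCast_iff_dvd_sub _ _ _).1 h2.symm)
      obtain ⟨m, hm⟩ := h3
      exact ⟨m, by linarith⟩
    choose m hm using h1
    refine ⟨∑ i, m i • e i, ?_⟩
    rw [← hc (X β), ← hc (X α), Finset.mul_sum, ← Finset.sum_add_distrib]
    refine Finset.sum_congr rfl fun i _ => ?_
    rw [hm i, add_smul]
    congr 1
    simp [mul_assoc, zsmul_eq_mul]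
  obtain ⟨r, hr⟩ := hdvd
  let y : D.R := ⟨star (X α).1, D.star_mem (X α).2⟩
  let γ' : D.R := 1 + (p : D.R) * (r * y)
  have hy : y * X α = (n : D.R) := Subtype.ext (by
    change star (X α).1 * (X α).1 = _
    rw [star_mul_eq, hXn α hα]; simp)
  have hγX : γ' * X α = X β := by
    rw [hr]
    simp only [γ', add_mul, one_mul, mul_assoc, hy]
    congr 1
    push_cast
    rw [← Nat.cast_comm n r]
    simp only [← mul_assoc]
    rw [← Nat.cast_mul, ← Nat.cast_mul, mul_comm p n]
  have hn' : (n : ℚ) ≠ 0 := by positivity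
  have hnrd : D.nrd γ' = 1 := by
    have := congrArg (fun z : D.R => D.nrd z) hγX
    simp only [Subring.coe_mul, nrd_mul, hXn α hα, hXn β hβS] at this
    exact mul_right_cancel₀ hn' (by rw [this, one_mul])
  have hmat : D.ιinf γ' * α.val = β.val := by
    rw [← hXg α hα, ← hXg β hβS, ← map_mul, ← Subring.coe_mul, hγX]
  refine ⟨β * α⁻¹, ⟨γ', hnrd, ?_, ?_⟩, ?_⟩
  · have : D.reduction γ' = 1 := by
      have hp0 : ((p : ℕ) : Matrix (Fin 2) (Fin 2) (ZMod p)) = 0 := by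
        rw [← map_natCast (algebraMap (ZMod p) (Matrix (Fin 2) (Fin 2) (ZMod p)))]
        simp
      simp only [γ', map_add, map_one, map_mul, map_natCast, hp0, zero_mul, add_zero]
    rw [this]
    exact U.one_mem
  · rw [Units.val_mul, ← hmat, mul_assoc, ← Units.val_mul, mul_inv_cancel]
    simp
  · rw [inv_mul_cancel_right]
    simpa using hβT

/-- The Jacobian of the compactification of `Γ \ ℋ`, for the group `Γ` of level `U`. -/
abbrev J (U : Submonoid (Matrix (Fin 2) (Fin 2) (ZMod p))) : Type := Jacobian (D.Gamma U)

/-- The double coset `Γ · 1 · Γ'`, for the groups `Γ`, `Γ'` of level `U`, `U'`. -/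
def doubleCoset (U U' : Submonoid (Matrix (Fin 2) (Fin 2) (ZMod p))) :
    HeckeCorrespondence (D.Gamma U) (D.Gamma U') where
  carrier := {g | ∃ γ ∈ D.Gamma U, ∃ γ' ∈ D.Gamma U', g = γ * 1 * γ'}
  det_pos := by
    rintro g ⟨γ, hγ, γ', hγ', rfl⟩
    simp [-Matrix.GeneralLinearGroup.val_det_apply, Subgroup.HasDetOne.det_eq hγ,
      Subgroup.HasDetOne.det_eq hγ']
  mul_mem_left := by
    rintro δ hδ g ⟨γ, hγ, γ', hγ', rfl⟩
    exact ⟨δ * γ, mul_mem hδ hγ, γ', hγ', by simp only [mul_assoc]⟩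
  mul_mem_right := by
    rintro δ hδ g ⟨γ, hγ, γ', hγ', rfl⟩
    exact ⟨γ, hγ, γ' * δ, mul_mem hγ' hδ, by simp only [mul_assoc]⟩
  finite_cosets := by
    refine D.exists_finset_cosets U one_pos ?_
    rintro g ⟨γ, ⟨x, hx, -, hxg⟩, γ', ⟨y, hy, -, hyg⟩, rfl⟩
    refine ⟨x * y, ?_, ?_⟩
    · rw [Subring.coe_mul, nrd_mul, hx, hy]; simp
    · rw [Subring.coe_mul, map_mul, hxg, hyg]; simp

/-- The elements `x ∈ R` of reduced norm `n` with `x_p mod p ∈ U`: the union of all double cosets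
`Γ α Γ` with such an `α`. For a prime number `n = ℓ` this defines the Hecke operator `T_ℓ`. -/
def hecke (U : Submonoid (Matrix (Fin 2) (Fin 2) (ZMod p))) (n : ℕ) (hn : 0 < n) :
    HeckeCorrespondence (D.Gamma U) (D.Gamma U) where
  carrier := {g | ∃ x : D.R, D.nrd x = n ∧ D.reduction x ∈ U ∧ D.ιinf x = g.val}
  det_pos := by
    rintro g ⟨x, hx, -, hxg⟩
    rw [Matrix.GeneralLinearGroup.val_det_apply, ← hxg, det_ιinf, hx]
    exact_mod_cast hn
  mul_mem_left := by
    rintro γ ⟨x, hx, hxU, hxg⟩ α ⟨y, hy, hyU, hyh⟩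
    refine ⟨x * y, ?_, ?_, ?_⟩
    · rw [Subring.coe_mul, nrd_mul, hx, hy, one_mul]
    · rw [map_mul]; exact U.mul_mem hxU hyU
    · rw [Subring.coe_mul, map_mul, hxg, hyh]; rfl
  mul_mem_right := by
    rintro γ ⟨x, hx, hxU, hxg⟩ α ⟨y, hy, hyU, hyh⟩
    refine ⟨y * x, ?_, ?_, ?_⟩
    · rw [Subring.coe_mul, nrd_mul, hx, hy, mul_one]
    · rw [map_mul]; exact U.mul_mem hyU hxU
    · rw [Subring.coe_mul, map_mul, hxg, hyh]; rfl
  finite_cosets := by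
    refine D.exists_finset_cosets U hn ?_
    rintro g ⟨x, hx, -, hxg⟩
    exact ⟨x, hx, hxg⟩

/-- The Hecke operator `T_n` on the Jacobian of level `U`. -/
def T (U : Submonoid (Matrix (Fin 2) (Fin 2) (ZMod p))) (n : ℕ) (hn : 0 < n) : D.J U →+ D.J U :=
  (D.hecke U n hn).onJacobian

/-- The homomorphism `J_{ns+} → J_{s+}` given by the double coset `Γ_{s+} · 1 · Γ_{ns+}`. -/
def doubleCosetMap (ε : ZMod p) : D.J (cartanNsPlus p ε) →+ D.J (cartanSPlus p) :=
  (D.doubleCoset (cartanSPlus p) (cartanNsPlus p ε)).onJacobian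

/-- The `p`-old part of `J_{s+}`. The two groups of Iwahori level that contain the split Cartan
group `Γ_s` intersect `Γ_{s+}` in `Γ_s`, so that the double coset of `Γ_{s+}` and one of them is
the pull-back to the curve `X_s` followed by the push-forward to `X_{s+}`. -/
def pOld : AddSubgroup (D.J (cartanSPlus p)) :=
  (D.doubleCoset (cartanSPlus p) (upperTriangular p)).onJacobian.range ⊔
    (D.doubleCoset (cartanSPlus p) (lowerTriangular p)).onJacobian.range

/-- The `p`-new quotient of `J_{s+}`. -/
abbrev JNew : Type := D.J (cartanSPlus p) ⧸ D.pOld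

/-- The homomorphism `J_{ns+} → J_{s+}^{p-new}` given by the double coset
`Γ_{s+} · 1 · Γ_{ns+}`. -/
def doubleCosetMapNew (ε : ZMod p) : D.J (cartanNsPlus p ε) →+ D.JNew :=
  (QuotientAddGroup.mk' D.pOld).comp (D.doubleCosetMap ε)

end ShimuraDatum

end

/-!
Let `U`, `U'` be two levels at `p` and `Γ`, `Γ'` the corresponding groups of elements of norm one.
If `U ∩ U'` contains a matrix of determinant `ℓ`, then the double coset `Γ · 1 · Γ'` commutes with
`T_ℓ` (`ShimuraDatum.doubleCoset_comm_T`). Indeed, by strong approximation every coset `Γ α` of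
elements of norm `ℓ` and level `U` has a representative whose level is also `U'`, and vice versa.
Hence both operators `T_ℓ` are given by the same representatives `σ`, while the double coset is
given by representatives `γ` in `Γ'`, and the products `σ γ` and `γ σ` represent the same cosets
(`HeckeCorrespondence.onForms_comm`). The condition on determinants holds for the pair of levels
`s+`, `ns+`, because `ε` is not a square, and for the pairs of `s+` and the triangular levels. The
latter show that the old part is stable.

The strong approximation needed is that the elements of norm one of the order `R` surject onto
`SL₂(𝔽_p)` (`ShimuraDatum.exists_reduction_eq`). The proof produces nontrivial upper and lower
transvections as reductions. Take `x ∈ R` that generates an imaginary quadratic order split at `p`.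
By a pigeonhole argument this order contains an element `β` whose norm is a power of `p` and whose
conjugates have distinct `p`-adic valuations (`exists_norm_eq_prime_pow`). Conjugation by `β ^ n`
then contracts one of the root subgroups of `SL₂(ℚ_p)` relative to the eigenlines of `x` and expands
the other. Since `B` is indefinite, there is also a real quadratic order in `R`, whose units
`a + b x₀` of norm one come from Pell's equation, and `b` may be given any large `p`-adic valuation
(`exists_pell_valuation`). For a suitable valuation the conjugate of `a + b x₀` by `β ^ n` lies in
`R`, and its reduction is a nontrivial transvection. Replacing `β` by its conjugate gives the other
type of transvection.
-/

/-! ### Commuting Hecke correspondences -/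

namespace HeckeCorrespondence

variable {Γ Γ' : Subgroup (GL (Fin 2) ℝ)}

/-- The coset `Γ α` of an element `α` of `S`. -/
def coset (S : HeckeCorrespondence Γ Γ') (α : GL (Fin 2) ℝ) (hα : α ∈ S.carrier) : S.Cosets :=
  Quotient.mk S.cosetSetoid ⟨α, hα⟩

lemma coset_eq_coset_iff (S : HeckeCorrespondence Γ Γ') {α β : GL (Fin 2) ℝ}
    (hα : α ∈ S.carrier) (hβ : β ∈ S.carrier) :
    S.coset α hα = S.coset β hβ ↔ ∃ γ ∈ Γ, γ * α = β :=
  Quotient.eq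

/-- The Hecke operator may be computed with any system of representatives of the cosets. -/
lemma coe_onForms_eq_sum (S : HeckeCorrespondence Γ Γ') {ι : Type*} [Fintype ι]
    (σ : ι → GL (Fin 2) ℝ) (hσ : ∀ i, σ i ∈ S.carrier)
    (hb : Function.Bijective fun i => S.coset (σ i) (hσ i)) (f : CuspForm Γ 2) :
    (S.onForms f : UpperHalfPlane → ℂ) =
      ∑ i, (f : UpperHalfPlane → ℂ) ∣[(2 : ℤ)] σ i :=
  (hb.sum_comp (S.slashTerm f)).symm

/-- Suppose that every coset in `S` (for `Γ`) and every coset in `S'` (for `Γ'`) has a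
representative in `S ∩ S'`, and that on `S ∩ S'` the two coset relations agree. If `σ` runs
through common representatives and `γ` through representatives in `Γ'` of `Γ \ Γ Γ'`, then the
products `γ σ` and the products `σ γ` represent the same cosets of `Γ`. -/
theorem onForms_comm (C : HeckeCorrespondence Γ Γ') (S : HeckeCorrespondence Γ Γ)
    (S' : HeckeCorrespondence Γ' Γ')
    (hC : ∀ α, α ∈ C.carrier ↔ ∃ γ ∈ Γ, ∃ γ' ∈ Γ', α = γ * γ')
    (hS : ∀ α ∈ S.carrier, ∃ γ ∈ Γ, γ * α ∈ S.carrier ∩ S'.carrier)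
    (hS' : ∀ α ∈ S'.carrier, ∃ γ ∈ Γ', γ * α ∈ S.carrier ∩ S'.carrier)
    (hΓ : ∀ γ ∈ Γ, ∀ α ∈ S.carrier ∩ S'.carrier, γ * α ∈ S.carrier ∩ S'.carrier → γ ∈ Γ')
    (hΓ' : ∀ γ ∈ Γ', ∀ α ∈ S.carrier ∩ S'.carrier, γ * α ∈ S.carrier ∩ S'.carrier → γ ∈ Γ)
    (hr : ∀ γ ∈ Γ', ∀ α ∈ S.carrier ∩ S'.carrier, α * γ ∈ S.carrier ∩ S'.carrier → γ ∈ Γ)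
    (f : CuspForm Γ 2) : S'.onForms (C.onForms f) = C.onForms (S.onForms f) := by
  have hrep' : ∀ i : S'.Cosets, ∃ α, ∃ h : α ∈ S.carrier ∩ S'.carrier, S'.coset α h.2 = i := by
    rintro ⟨α, hα⟩
    obtain ⟨γ, hγ, h⟩ := hS' α hα
    exact ⟨γ * α, h, ((S'.coset_eq_coset_iff hα h.2).2 ⟨γ, hγ, rfl⟩).symm⟩
  choose σ hσ hσi using hrep'
  have hrep : ∀ r : C.Cosets, ∃ γ, ∃ h : γ ∈ Γ', ∃ h' : γ ∈ C.carrier, C.coset γ h' = r := by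
    rintro ⟨α, hα⟩
    obtain ⟨γ, hγ, γ', hγ', rfl⟩ := (hC α).1 hα
    have h' : γ' ∈ C.carrier := (hC γ').2 ⟨1, Γ.one_mem, γ', hγ', (one_mul _).symm⟩
    exact ⟨γ', hγ', h', (C.coset_eq_coset_iff h' hα).2 ⟨γ, hγ, rfl⟩⟩
  choose g hg hgC hgr using hrep
  have hbS' : Function.Bijective fun i => S'.coset (σ i) (hσ i).2 := by
    simpa only [hσi] using! Function.bijective_id
  have hbC : Function.Bijective fun r => C.coset (g r) (hgC r) := by
    simpa only [hgr] using! Function.bijective_id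
  have hbS : Function.Bijective fun i => S.coset (σ i) (hσ i).1 := by
    constructor
    · intro i k h
      obtain ⟨γ, hγ, h⟩ := (S.coset_eq_coset_iff _ _).1 h
      refine hbS'.1 ((S'.coset_eq_coset_iff _ _).2 ⟨γ, ?_, h⟩)
      exact hΓ γ hγ _ (hσ i) (h ▸ hσ k)
    · rintro ⟨α, hα⟩
      obtain ⟨γ, hγ, h⟩ := hS α hα
      obtain ⟨i, hi⟩ := hbS'.2 (S'.coset (γ * α) h.2)
      obtain ⟨γ', hγ', h'⟩ := (S'.coset_eq_coset_iff _ _).1 hi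
      have h1 : γ' ∈ Γ := hΓ' γ' hγ' _ (hσ i) (h' ▸ h)
      exact ⟨i, (S.coset_eq_coset_iff _ _).2
        ⟨γ⁻¹ * γ', Γ.mul_mem (Γ.inv_mem hγ) h1, by rw [mul_assoc, h', inv_mul_cancel_left]⟩⟩
  -- `σ γ = γ' σ'` with `γ' ∈ Γ'`; the new pair is `(σ', γ')`
  have hswap : ∀ x : S'.Cosets × C.Cosets, ∃ y : S'.Cosets × C.Cosets, ∃ γ' ∈ Γ', ∃ δ ∈ Γ,
      σ x.1 * g x.2 = γ' * σ y.1 ∧ δ * g y.2 = γ' := by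
    rintro ⟨i, r⟩
    obtain ⟨i', hi'⟩ := hbS'.2
      (S'.coset (σ i * g r) (S'.mul_mem_right _ (hg r) _ (hσ i).2))
    obtain ⟨γ', hγ', h'⟩ := (S'.coset_eq_coset_iff _ _).1 hi'
    have hγC : γ' ∈ C.carrier := (hC γ').2 ⟨1, Γ.one_mem, γ', hγ', (one_mul _).symm⟩
    obtain ⟨r', hr'⟩ := hbC.2 (C.coset γ' hγC)
    obtain ⟨δ, hδ, h⟩ := (C.coset_eq_coset_iff _ _).1 hr'
    exact ⟨(i', r'), γ', hγ', δ, hδ, h'.symm, h⟩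
  choose φ γ' hγ' δ hδ hφ hφ' using hswap
  have hinj : Function.Injective φ := by
    intro x y hxy
    have h1 : δ y * (δ x)⁻¹ * γ' x = γ' y := by
      rw [← hφ' x, ← hφ' y, hxy, mul_assoc, inv_mul_cancel_left]
    set κ := δ y * (δ x)⁻¹ with hκ_def
    have hκ : κ ∈ Γ := Γ.mul_mem (hδ y) (Γ.inv_mem (hδ x))
    have hκ' : κ ∈ Γ' := by
      rw [eq_mul_inv_of_mul_eq h1]
      exact Γ'.mul_mem (hγ' y) (Γ'.inv_mem (hγ' x))
    have h2 : κ * (σ x.1 * g x.2) = σ y.1 * g y.2 := by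
      rw [hφ x, hφ y, ← mul_assoc, h1, hxy]
    have h3 : σ y.1 * (g y.2 * (g x.2)⁻¹) = κ * σ x.1 := by
      rw [← mul_assoc, ← h2]
      simp [mul_assoc]
    have h4 : g y.2 * (g x.2)⁻¹ ∈ Γ := by
      refine hr _ (Γ'.mul_mem (hg _) (Γ'.inv_mem (hg _))) _ (hσ y.1) ?_
      rw [h3]
      exact ⟨S.mul_mem_left _ hκ _ (hσ _).1, S'.mul_mem_left _ hκ' _ (hσ _).2⟩
    have h5 : x.2 = y.2 := hbC.1 ((C.coset_eq_coset_iff _ _).2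
      ⟨_, h4, inv_mul_cancel_right _ _⟩)
    have h6 : x.1 = y.1 := by
      refine hbS'.1 ((S'.coset_eq_coset_iff _ _).2 ⟨κ, hκ', ?_⟩)
      rw [← h3, h5, mul_inv_cancel, mul_one]
    exact Prod.ext h6 h5
  have hterm : ∀ x, (f : UpperHalfPlane → ℂ) ∣[(2 : ℤ)] (σ x.1 * g x.2) =
      (f : UpperHalfPlane → ℂ) ∣[(2 : ℤ)] (g (φ x).2 * σ (φ x).1) := by
    intro x
    rw [hφ x, ← hφ' x, mul_assoc, SlashAction.slash_mul,
      SlashInvariantFormClass.slash_action_eq f _ (hδ x)]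
  refine DFunLike.coe_injective ?_
  rw [S'.coe_onForms_eq_sum σ (fun i => (hσ i).2) hbS', C.coe_onForms_eq_sum g hgC hbC]
  rw [C.coe_onForms_eq_sum g hgC hbC (S.onForms f),
    S.coe_onForms_eq_sum σ (fun i => (hσ i).1) hbS]
  simp only [SlashAction.sum_slash, ← SlashAction.slash_mul]
  refine (Fintype.sum_prod_type'
    fun i r => (f : UpperHalfPlane → ℂ) ∣[(2 : ℤ)] (g r * σ i)).symm.trans (Eq.trans ?_
      (Fintype.sum_prod_type_right' fun i r => (f : UpperHalfPlane → ℂ) ∣[(2 : ℤ)] (σ i * g r)))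
  simp only [hterm]
  exact ((Finite.injective_iff_bijective.1 hinj).sum_comp
    fun y => (f : UpperHalfPlane → ℂ) ∣[(2 : ℤ)] (g y.2 * σ y.1)).symm

lemma onJacobian_comm [Γ.HasDetOne] [Γ'.HasDetOne] (C : HeckeCorrespondence Γ Γ')
    (S : HeckeCorrespondence Γ Γ) (S' : HeckeCorrespondence Γ' Γ')
    (h : ∀ f, S'.onForms (C.onForms f) = C.onForms (S.onForms f)) :
    C.onJacobian.comp S'.onJacobian = S.onJacobian.comp C.onJacobian := by
  refine AddMonoidHom.ext fun x => ?_
  obtain ⟨φ, rfl⟩ := QuotientAddGroup.mk_surjective x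
  refine congrArg (QuotientAddGroup.mk (s := periodLattice Γ)) ?_
  exact LinearMap.ext fun f => congrArg φ (h f)

end HeckeCorrespondence

/-! ### The order and its completion at `p` -/

namespace ShimuraDatum

variable {p : ℕ} [Fact p.Prime] (D : ShimuraDatum p)

/-- The canonical involution of the order. -/
def conj (x : D.R) : D.R := ⟨star x.1, D.star_mem x.2⟩

@[simp] lemma coe_conj (x : D.R) : (D.conj x : D.B) = star (x : D.B) := rfl

lemma exists_int_nrd (x : D.R) : ∃ n : ℤ, D.nrd x = n := by
  have := D.finite_R
  obtain ⟨P, hP, hPx⟩ := IsIntegral.of_finite ℤ (x * D.conj x)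
  have h := congrArg D.R.subtype hPx
  rw [map_zero, Polynomial.hom_eval₂, map_mul] at h
  change Polynomial.eval₂ _ (x.1 * star x.1) P = 0 at h
  rw [mul_star_eq, show (D.R.subtype.comp (algebraMap ℤ D.R)) =
    (algebraMap ℚ D.B).comp (algebraMap ℤ ℚ) from RingHom.ext_int _ _,
    ← Polynomial.hom_eval₂] at h
  have h0 : Polynomial.aeval (D.nrd x) P = 0 :=
    (FaithfulSMul.algebraMap_injective ℚ D.B) (h.trans (map_zero _).symm)
  obtain ⟨n, hn⟩ := isInteger_of_is_root_of_monic hP h0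
  exact ⟨n, by rw [← hn]; simp⟩

/-- The reduced trace as an integer. -/
noncomputable def intTrd (x : D.R) : ℤ := (D.exists_int_trace x.2).choose

/-- The reduced norm as an integer. -/
noncomputable def intNrd (x : D.R) : ℤ := (D.exists_int_nrd x).choose

lemma coe_intTrd (x : D.R) : (D.intTrd x : ℚ) = 2 * (x : D.B).re :=
  (D.exists_int_trace x.2).choose_spec.symm

lemma coe_intNrd (x : D.R) : (D.intNrd x : ℚ) = D.nrd x := (D.exists_int_nrd x).choose_spec.symm

lemma intTrd_add (x y : D.R) : D.intTrd (x + y) = D.intTrd x + D.intTrd y := by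
  have : (D.intTrd (x + y) : ℚ) = D.intTrd x + D.intTrd y := by
    simp only [coe_intTrd, Subring.coe_add, QuaternionAlgebra.re_add, mul_add]
  exact_mod_cast this

lemma intNrd_mul (x y : D.R) : D.intNrd (x * y) = D.intNrd x * D.intNrd y := by
  have : (D.intNrd (x * y) : ℚ) = D.intNrd x * D.intNrd y := by
    simp only [coe_intNrd, Subring.coe_mul, nrd_mul]
  exact_mod_cast this

lemma conj_mul (x : D.R) : D.conj x * x = (D.intNrd x : D.R) := by
  refine Subtype.ext ?_
  change star x.1 * x.1 = _
  rw [star_mul_eq, ← coe_intNrd]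
  simp

lemma add_conj (x : D.R) : x + D.conj x = (D.intTrd x : D.R) := by
  refine Subtype.ext ?_
  have h : (((D.intTrd x : ℤ) : D.R) : D.B) = algebraMap ℚ D.B (D.intTrd x) := by simp
  rw [h, coe_intTrd, Subring.coe_add, coe_conj]
  ext <;> simp [QuaternionAlgebra.algebraMap_eq]; ring

lemma conj_eq (x : D.R) : D.conj x = (D.intTrd x : D.R) - x :=
  eq_sub_of_add_eq' (D.add_conj x)

lemma sq_eq (x : D.R) : x * x = (D.intTrd x : D.R) * x - (D.intNrd x : D.R) := by
  rw [← add_conj, ← conj_mul]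
  noncomm_ring

lemma intNrd_add_mul_intCast (x : D.R) (a b : ℤ) :
    D.intNrd ((a : D.R) + (b : D.R) * x) = a ^ 2 + D.intTrd x * a * b + D.intNrd x * b ^ 2 := by
  have h : (D.intNrd ((a : D.R) + (b : D.R) * x) : ℚ) =
      a ^ 2 + D.intTrd x * a * b + D.intNrd x * b ^ 2 := by
    simp only [coe_intNrd, coe_intTrd, nrd, Subring.coe_add, Subring.coe_mul, Subring.coe_intCast]
    simp
    ring
  exact_mod_cast h

lemma conj_add_mul_intCast (x : D.R) (a b : ℤ) :
    D.conj ((a : D.R) + (b : D.R) * x) = (a : D.R) + (b : D.R) * D.conj x := by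
  refine Subtype.ext ?_
  simp [(Int.commute_cast (star x.1) b).eq]

lemma intNrd_intCast (n : ℤ) : D.intNrd (n : D.R) = n ^ 2 := by
  simpa using D.intNrd_add_mul_intCast 1 n 0

/-- Reduction modulo `p` of matrices. -/
noncomputable def redMatrix (p : ℕ) [Fact p.Prime] :
    Matrix (Fin 2) (Fin 2) ℤ_[p] →+* Matrix (Fin 2) (Fin 2) (ZMod p) :=
  (PadicInt.toZMod (p := p)).mapMatrix

lemma reduction_apply (x : D.R) : D.reduction x = redMatrix p (D.ιp x) := rfl

lemma redMatrix_smul (z : ℤ_[p]) (A : Matrix (Fin 2) (Fin 2) ℤ_[p]) :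
    redMatrix p (z • A) = PadicInt.toZMod z • redMatrix p A := by
  ext i j
  simp [redMatrix]

lemma reduction_surjective : Function.Surjective D.reduction := by
  intro A
  obtain ⟨Y, rfl⟩ : ∃ Y, redMatrix p Y = A := by
    refine ⟨A.map fun a => ((a.val : ℕ) : ℤ_[p]), ?_⟩
    ext i j
    simp [redMatrix]
  have hY : Y ∈ Submodule.span ℤ_[p] (Set.range D.ιp) := D.span_ιp ▸ Submodule.mem_top
  induction hY using Submodule.span_induction with
  | mem Y h =>
    obtain ⟨x, rfl⟩ := h
    exact ⟨x, rfl⟩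
  | zero => exact ⟨0, by simp⟩
  | add Y Z _ _ hY hZ =>
    obtain ⟨x, hx⟩ := hY
    obtain ⟨y, hy⟩ := hZ
    exact ⟨x + y, by simp [hx, hy]⟩
  | smul z Y _ hY =>
    obtain ⟨x, hx⟩ := hY
    refine ⟨((PadicInt.toZMod z).val : ℕ) • x, ?_⟩
    rw [map_nsmul, hx, redMatrix_smul, ← Nat.cast_smul_eq_nsmul (ZMod p), ZMod.natCast_val,
      ZMod.cast_id]

/-- Both `R / p R` and `M₂(𝔽_p)` have `p ^ 4` elements. -/
lemma exists_eq_p_mul_of_reduction_eq_zero {x : D.R} (hx : D.reduction x = 0) :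
    ∃ y : D.R, x = (p : D.R) * y := by
  have := D.finite_R
  have : IsAddTorsionFree D.B := IsAddTorsionFree.of_module_rat _
  have : IsAddTorsionFree D.R := 
    Function.Injective.isAddTorsionFree D.R.subtype.toAddMonoidHom Subtype.val_injective
  let e := Module.Free.chooseBasis ℤ D.R
  set I := Module.Free.ChooseBasisIndex ℤ D.R
  have hI : Fintype.card I ≤ 4 := by
    have h1 : LinearIndependent ℤ fun i => (e i : D.B) :=
      e.linearIndependent.map' (D.R.subtype.toIntAlgHom.toLinearMap)
        (LinearMap.ker_eq_bot.2 Subtype.val_injective)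
    have h2 : LinearIndependent ℚ fun i => (e i : D.B) :=
      (LinearIndependent.iff_fractionRing ℤ ℚ).1 h1
    have h3 := h2.fintype_card_le_finrank
    rwa [QuaternionAlgebra.finrank_eq_four] at h3
  let F : (I → ZMod p) →ₗ[ZMod p] Matrix (Fin 2) (Fin 2) (ZMod p) :=
    Fintype.linearCombination (ZMod p) fun i => D.reduction (e i)
  have hF : ∀ y : D.R, F (fun i => ((e.repr y i : ℤ) : ZMod p)) = D.reduction y := by
    intro y
    conv_rhs => rw [← e.sum_repr y]
    simp only [F, Fintype.linearCombination_apply, map_sum, map_zsmul]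
    exact Finset.sum_congr rfl fun i _ => Int.cast_smul_eq_zsmul _ _ _
  have hs : Function.Surjective F := fun A => by
    obtain ⟨y, rfl⟩ := D.reduction_surjective A
    exact ⟨_, hF y⟩
  have hd : Module.finrank (ZMod p) (I → ZMod p) =
      Module.finrank (ZMod p) (Matrix (Fin 2) (Fin 2) (ZMod p)) := by
    refine le_antisymm ?_ (LinearMap.finrank_le_finrank_of_surjective hs)
    simpa [Module.finrank_matrix] using hI
  have hinj := (LinearMap.injective_iff_surjective_of_finrank_eq_finrank hd).2 hs
  have h0 : (fun i => ((e.repr x i : ℤ) : ZMod p)) = 0 := hinj (by rw [hF, hx, map_zero])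
  have h1 : ∀ i, ∃ m : ℤ, e.repr x i = p * m := fun i =>
    (ZMod.intCast_zmod_eq_zero_iff_dvd _ _).1 (congrFun h0 i)
  choose m hm using h1
  refine ⟨∑ i, m i • e i, ?_⟩
  conv_lhs => rw [← e.sum_repr x]
  rw [Finset.mul_sum]
  refine Finset.sum_congr rfl fun i _ => ?_
  rw [hm, mul_smul, natCast_zsmul, nsmul_eq_mul]

lemma intCast_matrix_mul {A : Type*} [CommRing A] (n : ℤ) (X : Matrix (Fin 2) (Fin 2) A) :
    (n : Matrix (Fin 2) (Fin 2) A) * X = (n : A) • X := by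
  rw [← zsmul_eq_mul, Int.cast_smul_eq_zsmul]

lemma natCast_matrix_mul {A : Type*} [CommRing A] (n : ℕ) (X : Matrix (Fin 2) (Fin 2) A) :
    (n : Matrix (Fin 2) (Fin 2) A) * X = (n : A) • X := by
  rw [← nsmul_eq_mul, Nat.cast_smul_eq_nsmul]

lemma exists_eq_p_pow_mul {k : ℕ} {x : D.R} {W : Matrix (Fin 2) (Fin 2) ℤ_[p]}
    (hx : D.ιp x = (p : ℤ_[p]) ^ k • W) : ∃ y : D.R, x = (p : D.R) ^ k * y ∧ D.ιp y = W := by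
  induction k generalizing x with
  | zero => exact ⟨x, by simp, by simpa using hx⟩
  | succ k ih =>
    obtain ⟨y, rfl⟩ := D.exists_eq_p_mul_of_reduction_eq_zero (x := x) (by
      rw [reduction_apply, hx, redMatrix_smul]
      simp)
    have hy : D.ιp y = (p : ℤ_[p]) ^ k • W := by
      have hp0 : (p : ℤ_[p]) ≠ 0 := by exact_mod_cast (Fact.out : p.Prime).ne_zero
      refine smul_right_injective _ hp0 ?_
      simp only [smul_smul, ← pow_succ', ← hx, map_mul, map_natCast, natCast_matrix_mul]
    obtain ⟨z, rfl, hz⟩ := ih hy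
    exact ⟨z, by rw [pow_succ', mul_assoc], hz⟩

lemma matrix_sq (Y : Matrix (Fin 2) (Fin 2) ℤ_[p]) :
    Y * Y = Y.trace • Y - Y.det • (1 : Matrix (Fin 2) (Fin 2) ℤ_[p]) := by
  ext i j
  fin_cases i <;> fin_cases j <;>
    simp [Matrix.mul_apply, Fin.sum_univ_two, Matrix.trace_fin_two, Matrix.det_fin_two] <;> ring

lemma ιp_sq (x : D.R) : D.ιp x * D.ιp x =
    (D.intTrd x : ℤ_[p]) • D.ιp x -
      (D.intNrd x : ℤ_[p]) • (1 : Matrix (Fin 2) (Fin 2) ℤ_[p]) := by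
  rw [← map_mul, sq_eq, map_sub, map_mul, map_intCast, map_intCast, ← intCast_matrix_mul,
    ← intCast_matrix_mul, mul_one]

lemma trace_ιp (x : D.R) : (D.ιp x).trace = D.intTrd x := by
  -- if `ιp y` is not scalar, then its minimal polynomial is its characteristic polynomial
  have key : ∀ y : D.R, D.ιp y 0 1 ≠ 0 → (D.ιp y).trace = D.intTrd y := by
    intro y hy
    have h := congrFun (congrFun ((D.ιp_sq y).symm.trans (matrix_sq _)) 0) 1
    simp at h
    exact (h.resolve_right hy).symm
  obtain ⟨y, hy⟩ := D.reduction_surjective !![0, 1; 0, 0]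
  have hy1 : D.ιp y 0 1 ≠ 0 := by
    intro h
    have h1 := congrFun (congrFun hy 0) 1
    rw [reduction_apply] at h1
    simp [redMatrix, h] at h1
  by_cases hx : D.ιp x 0 1 = 0
  · have h1 := key (x + y) (by simpa [hx] using hy1)
    rw [map_add, Matrix.trace_add, key y hy1, intTrd_add] at h1
    push_cast at h1
    exact add_right_cancel h1
  · exact key x hx

lemma det_ιp (x : D.R) : (D.ιp x).det = D.intNrd x := by
  have h := congrFun (congrFun ((D.ιp_sq x).symm.trans (matrix_sq _)) 0) 0
  rw [trace_ιp] at h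
  simpa using h.symm

lemma det_reduction (x : D.R) : (D.reduction x).det = D.intNrd x := by
  rw [reduction_apply, redMatrix, ← RingHom.map_det, det_ιp, map_intCast]

lemma trace_reduction (x : D.R) : (D.reduction x).trace = D.intTrd x := by
  have := congrArg (PadicInt.toZMod (p := p)) (D.trace_ιp x)
  rw [map_intCast] at this
  rw [← this, reduction_apply, redMatrix]
  simp [Matrix.trace_fin_two]

lemma reduction_conj (x : D.R) : D.reduction (D.conj x) = (D.reduction x).adjugate := by
  have h := D.trace_reduction x
  rw [Matrix.trace_fin_two] at h
  rw [conj_eq, map_sub, map_intCast,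
    ← mul_one ((D.intTrd x : ℤ) : Matrix (Fin 2) (Fin 2) (ZMod p)), intCast_matrix_mul, ← h, Matrix.adjugate_fin_two]
  ext i j
  fin_cases i <;> fin_cases j <;> simp

lemma ιinf_injective : Function.Injective D.ιinf := by
  have ha := D.a_ne_zero
  have hb := D.b_ne_zero
  refine (injective_iff_map_eq_zero _).2 fun x hx => ?_
  have h : ∀ y : D.B, (x * y).re = 0 := by
    intro y
    have h1 := D.trace_ιinf (x * y)
    rw [map_mul, hx, zero_mul, Matrix.trace_zero] at h1
    have : ((x * y).re : ℝ) = 0 := by linarith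
    exact_mod_cast this
  have h1 := h 1
  have h2 := h ⟨0, 1, 0, 0⟩
  have h3 := h ⟨0, 0, 1, 0⟩
  have h4 := h ⟨0, 0, 0, 1⟩
  simp [ha, hb] at h1 h2 h3 h4
  ext <;> simp [h1, h2, h3, h4]

lemma exists_smul_mem (y : D.B) : ∃ m : ℤ, m ≠ 0 ∧ (m : D.B) * y ∈ D.R := by
  have hy : y ∈ Submodule.span ℚ (D.R : Set D.B) := D.span_R ▸ Submodule.mem_top
  induction hy using Submodule.span_induction with
  | mem y h => exact ⟨1, one_ne_zero, by simpa using h⟩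
  | zero => exact ⟨1, one_ne_zero, by simp⟩
  | add y z _ _ hy hz =>
    obtain ⟨m, hm, hy⟩ := hy
    obtain ⟨n, hn, hz⟩ := hz
    refine ⟨m * n, mul_ne_zero hm hn, ?_⟩
    have h1 := D.R.add_mem (D.R.mul_mem (intCast_mem D.R n) hy)
      (D.R.mul_mem (intCast_mem D.R m) hz)
    convert h1 using 1
    push_cast
    rw [mul_add, ← mul_assoc, ← mul_assoc, (Int.cast_commute m (n : D.B)).eq]
  | smul q y _ hy =>
    obtain ⟨m, hm, hy⟩ := hy
    refine ⟨q.den * m, mul_ne_zero (by exact_mod_cast q.den_ne_zero) hm, ?_⟩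
    have h1 := D.R.mul_mem (intCast_mem D.R q.num) hy
    convert h1 using 1
    have h2 : ∀ (k : ℤ) (z : D.B), (k : D.B) * z = (k : ℚ) • z := fun k z => by
      ext <;> simp
    simp only [h2, smul_smul]
    congr 1
    push_cast
    rw [mul_right_comm, mul_comm (q.den : ℚ), Rat.mul_den_eq_num]

lemma exists_pure_of_nrd {y : D.B} (hy : y.re = 0) {s : ℚ} (hs : 0 < s * D.nrd y) :
    ∃ w : D.R, D.intTrd w = 0 ∧ 0 < s * D.intNrd w := by
  obtain ⟨m, hm, h⟩ := D.exists_smul_mem y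
  refine ⟨⟨_, h⟩, ?_, ?_⟩
  · have : (D.intTrd ⟨_, h⟩ : ℚ) = 0 := by
      rw [coe_intTrd]
      simp [hy]
    exact_mod_cast this
  · rw [coe_intNrd, nrd_mul, show D.nrd (m : D.B) = m ^ 2 by simp [nrd, sq]]
    have : (0 : ℚ) < m ^ 2 := by positivity
    nlinarith [mul_pos this hs]

lemma exists_pure_nrd_pos : ∃ w : D.R, D.intTrd w = 0 ∧ 0 < D.intNrd w := by
  suffices h : ∃ y : D.B, y.re = 0 ∧ 0 < D.nrd y by
    obtain ⟨y, hy, h⟩ := h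
    obtain ⟨w, hw, h⟩ := D.exists_pure_of_nrd hy (s := 1) (by simpa using h)
    exact ⟨w, hw, by exact_mod_cast (by simpa using h : (0 : ℚ) < D.intNrd w)⟩
  rcases lt_or_gt_of_ne D.a_ne_zero with ha | ha
  · exact ⟨⟨0, 1, 0, 0⟩, rfl, by simpa [nrd] using ha⟩
  rcases lt_or_gt_of_ne D.b_ne_zero with hb | hb
  · exact ⟨⟨0, 0, 1, 0⟩, rfl, by simpa [nrd] using hb⟩
  · exact ⟨⟨0, 0, 0, 1⟩, rfl, by simpa [nrd] using mul_pos ha hb⟩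

/-- The algebra is indefinite: `M₂(ℝ)` does not contain two anticommuting matrices with negative
squares, as the traceless symmetric matrices have codimension one among the traceless matrices,
and their determinants are not positive. -/
lemma exists_pure_nrd_neg : ∃ w : D.R, D.intTrd w = 0 ∧ D.intNrd w < 0 := by
  suffices h : ∃ y : D.B, y.re = 0 ∧ D.nrd y < 0 by
    obtain ⟨y, hy, h⟩ := h
    obtain ⟨w, hw, h⟩ := D.exists_pure_of_nrd hy (s := -1) (by simpa using h)
    exact ⟨w, hw, by exact_mod_cast (by simpa using h : (D.intNrd w : ℚ) < 0)⟩
  rcases lt_or_gt_of_ne D.a_ne_zero with ha | ha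
  swap
  · exact ⟨⟨0, 1, 0, 0⟩, rfl, by simpa [nrd] using ha⟩
  rcases lt_or_gt_of_ne D.b_ne_zero with hb | hb
  swap
  · exact ⟨⟨0, 0, 1, 0⟩, rfl, by simpa [nrd] using hb⟩
  exfalso
  have hi := D.det_ιinf ⟨0, 1, 0, 0⟩
  have hj := D.det_ιinf ⟨0, 0, 1, 0⟩
  have hij := D.det_ιinf (⟨0, 1, 0, 0⟩ + ⟨0, 0, 1, 0⟩)
  have ti := D.trace_ιinf ⟨0, 1, 0, 0⟩
  have tj := D.trace_ιinf ⟨0, 0, 1, 0⟩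
  rw [map_add] at hij
  generalize D.ιinf ⟨0, 1, 0, 0⟩ = I at *
  generalize D.ιinf ⟨0, 0, 1, 0⟩ = J at *
  simp [nrd, Matrix.det_fin_two, Matrix.trace_fin_two] at hi hj hij ti tj
  have ha' : (D.a : ℝ) < 0 := by exact_mod_cast ha
  have hb' : (D.b : ℝ) < 0 := by exact_mod_cast hb
  obtain ⟨s, hs⟩ : ∃ s, s = J 0 1 - J 1 0 := ⟨_, rfl⟩
  obtain ⟨t, ht⟩ : ∃ t, t = I 1 0 - I 0 1 := ⟨_, rfl⟩
  have h1 : (s * I 0 0 + t * J 0 0) ^ 2 + (s * I 0 1 + t * J 0 1) ^ 2 =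
      D.a * s ^ 2 + D.b * t ^ 2 := by
    have e1 : I 1 1 = -I 0 0 := by linarith
    have e2 : J 1 1 = -J 0 0 := by linarith
    rw [e1] at hi hij
    rw [e2] at hj hij
    linear_combination -s ^ 2 * hi - t ^ 2 * hj - s * t * (hij - hi - hj) -
      (s * I 0 1 + t * J 0 1) * (t * hs - s * ht)
  have hs0 : s = 0 := by
    by_contra h
    nlinarith [sq_nonneg (s * I 0 0 + t * J 0 0), sq_nonneg (s * I 0 1 + t * J 0 1),
      mul_pos_of_neg_of_neg ha' (neg_lt_zero.2 (sq_pos_of_ne_zero h)), sq_nonneg t]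
  have ht0 : t = 0 := by
    by_contra h
    nlinarith [sq_nonneg (s * I 0 0 + t * J 0 0), sq_nonneg (s * I 0 1 + t * J 0 1),
      mul_pos_of_neg_of_neg hb' (neg_lt_zero.2 (sq_pos_of_ne_zero h)), sq_nonneg s]
  have h2 : I 1 0 = I 0 1 := by linarith
  have h3 : I 1 1 = -I 0 0 := by linarith
  rw [h2, h3] at hi
  nlinarith [sq_nonneg (I 0 0), sq_nonneg (I 0 1)]

end ShimuraDatum

/-! ### Pell's equation and powers of a prime number -/

lemma exists_quadratic_gt {a : ℤ} (ha : 0 < a) (b c k : ℤ) :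
    ∃ N : ℤ, k < a * N ^ 2 + b * N + c := by
  refine ⟨|b| + |k - c| + 1, ?_⟩
  have h1 := abs_nonneg b
  have h2 := abs_nonneg (k - c)
  have h3 := neg_abs_le b
  have h4 := le_abs_self (k - c)
  set N := |b| + |k - c| + 1 with hN
  have h5 : N ^ 2 ≤ a * N ^ 2 := le_mul_of_one_le_left (sq_nonneg _) ha
  have h6 : -|b| * N ≤ b * N := by gcongr
  have h7 : |k - c| < N * (|k - c| + 1) := by nlinarith
  nlinarith

/-- The powers of a solution `(a, b)` of Pell's equation that is congruent to `(1, 0)`. -/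
lemma exists_pell_pow {d a b q : ℤ} (h : a ^ 2 - d * b ^ 2 = 1) (ha : q ∣ a - 1)
    (hb : q ∣ b ^ 2) (m : ℕ) :
    ∃ A s : ℤ, A ^ 2 - d * (b * (m + q * s)) ^ 2 = 1 ∧ q ∣ A - 1 := by
  induction m with
  | zero => exact ⟨1, 0, by simp, by simp⟩
  | succ m ih =>
    obtain ⟨A, s, hA, h1⟩ := ih
    obtain ⟨α, hα⟩ := ha
    obtain ⟨α', hα'⟩ := h1
    obtain ⟨β, hβ⟩ := hb
    refine ⟨A * a + d * b ^ 2 * (m + q * s), α' + s * a + m * α, ?_, ?_⟩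
    · have : b * (((m + 1 : ℕ) : ℤ) + q * (α' + s * a + m * α)) =
          A * b + b * (m + q * s) * a := by
        push_cast
        linear_combination (-b) * hα' - b * m * hα
      rw [this]
      linear_combination (a ^ 2 - d * b ^ 2) * hA + h
    · refine ⟨α' * a + α + d * β * (m + q * s), ?_⟩
      rw [hβ]
      linear_combination hα + a * hα'

/-- Pell's equation has solutions `(a, b)` with `a ≡ 1` modulo `p` in which `b` has any prescribed,
sufficiently large `p`-adic valuation: taking `p`-th powers raises the valuation by one. -/
lemma exists_pell_valuation {p : ℕ} (hp : p.Prime) {d : ℤ} (hd : 0 < d)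
    (hd' : ¬ IsSquare d) : ∃ v₀ : ℕ, ∀ v, v₀ ≤ v → ∃ a b : ℤ,
      a ^ 2 - d * (p ^ v * b) ^ 2 = 1 ∧ (p : ℤ) ∣ a - 1 ∧ ¬ (p : ℤ) ∣ b := by
  have hpZ : Prime (p : ℤ) := Nat.prime_iff_prime_int.1 hp
  have hp0 : (p : ℤ) ≠ 0 := hpZ.ne_zero
  have hdp : ¬ IsSquare (d * p ^ 2) := by
    rintro ⟨r, hr⟩
    have h1 : (p : ℤ) ∣ r := by
      refine (Int.pow_dvd_pow_iff two_ne_zero).1 ⟨d, ?_⟩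
      rw [sq r, ← hr, mul_comm]
    obtain ⟨r, rfl⟩ := h1
    refine hd' ⟨r, mul_right_cancel₀ (pow_ne_zero 2 hp0) ?_⟩
    rw [hr]
    ring
  obtain ⟨a, b, hab, hb⟩ := Pell.exists_of_not_isSquare (by positivity : 0 < d * p ^ 2) hdp
  have ha : a ≠ 0 := by
    rintro rfl
    nlinarith [mul_nonneg (mul_nonneg hd.le (sq_nonneg (p : ℤ))) (sq_nonneg b)]
  obtain ⟨v, B, hB, hBv⟩ : ∃ v : ℕ, ∃ B : ℤ, ¬ (p : ℤ) ∣ B ∧ 2 * a * (p * b) = p ^ v * B := by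
    have hfin : FiniteMultiplicity (p : ℤ) (2 * a * (p * b)) :=
      Int.finiteMultiplicity_iff.2 ⟨by simpa using hp.ne_one, by positivity⟩
    obtain ⟨c, hc, hc'⟩ := hfin.exists_eq_pow_mul_and_not_dvd
    exact ⟨_, c, hc', hc⟩
  have hv : 1 ≤ v := by
    by_contra h
    obtain rfl : v = 0 := by omega
    refine hB ⟨2 * a * b, ?_⟩
    rw [pow_zero, one_mul] at hBv
    rw [← hBv]
    ring
  -- the square of a solution with `p ∣ b` has `a ≡ 1` modulo `p ^ 2`
  have hbase : (1 + 2 * d * p ^ 2 * b ^ 2) ^ 2 - d * (p ^ v * B) ^ 2 = 1 := by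
    rw [← hBv]
    linear_combination (-4 * d * p ^ 2 * b ^ 2) * hab
  suffices H : ∀ k : ℕ, ∃ a b : ℤ, a ^ 2 - d * (p ^ (v + k) * b) ^ 2 = 1 ∧
      (p : ℤ) ^ 2 ∣ a - 1 ∧ ¬ (p : ℤ) ∣ b by
    refine ⟨v, fun w hw => ?_⟩
    obtain ⟨a, b, h1, h2, h3⟩ := H (w - v)
    rw [Nat.add_sub_cancel' hw] at h1
    exact ⟨a, b, h1, (dvd_pow_self _ two_ne_zero).trans h2, h3⟩
  intro k
  induction k with
  | zero => exact ⟨_, B, hbase, ⟨2 * d * b ^ 2, by ring⟩, hB⟩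
  | succ k ih =>
    obtain ⟨a, b, h1, h2, h3⟩ := ih
    obtain ⟨A, s, hA, hA'⟩ := exists_pell_pow h1 h2 (by
      rw [mul_pow, ← pow_mul]
      exact Dvd.dvd.mul_right (pow_dvd_pow _ (by omega)) _) p
    refine ⟨A, b * (1 + p * s), ?_, hA', ?_⟩
    · refine Eq.trans ?_ hA
      ring
    · refine hpZ.not_dvd_mul h3 fun h => hpZ.not_dvd_one ?_
      exact (dvd_add_left (dvd_mul_right _ s)).1 h

/-- Thue's lemma: a lattice of index `p ^ (2 m)` contains a nonzero point with coordinates of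
absolute value at most `p ^ m`. -/
lemma exists_small_dvd_add_mul {p : ℕ} [Fact p.Prime] (μ : ℤ_[p]) (m : ℕ) :
    ∃ a b : ℤ, (a ≠ 0 ∨ b ≠ 0) ∧ |a| ≤ p ^ m ∧ |b| ≤ p ^ m ∧
      (p : ℤ_[p]) ^ (2 * m) ∣ a + b * μ := by
  have : NeZero (p ^ (2 * m)) := ⟨pow_ne_zero _ (Fact.out : p.Prime).ne_zero⟩
  let F : Fin (p ^ m + 1) × Fin (p ^ m + 1) → ZMod (p ^ (2 * m)) := fun x =>
    PadicInt.toZModPow (2 * m) (((x.1 : ℕ) : ℤ_[p]) + ((x.2 : ℕ) : ℤ_[p]) * μ)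
  obtain ⟨x, y, hxy, h⟩ := Fintype.exists_ne_map_eq_of_card_lt F (by
    rw [ZMod.card, Fintype.card_prod, Fintype.card_fin, mul_comm 2 m, pow_mul]
    generalize p ^ m = q
    nlinarith)
  have hx1 := x.1.2
  have hx2 := x.2.2
  have hy1 := y.1.2
  have hy2 := y.2.2
  rw [← Nat.cast_pow]
  refine ⟨((x.1 : ℕ) : ℤ) - (y.1 : ℕ), ((x.2 : ℕ) : ℤ) - (y.2 : ℕ), ?_, ?_, ?_, ?_⟩
  · by_contra! h0
    exact hxy (Prod.ext (Fin.ext (by omega)) (Fin.ext (by omega)))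
  · rw [abs_le]
    constructor <;> omega
  · rw [abs_le]
    constructor <;> omega
  · rw [← Ideal.mem_span_singleton, ← PadicInt.ker_toZModPow, RingHom.mem_ker]
    rw [← sub_eq_zero, ← map_sub] at h
    rw [← h]
    congr 1
    push_cast
    ring

/-- In an imaginary quadratic order, some element has norm a power of `p` and two conjugates of
distinct `p`-adic valuations. By Thue's lemma there are elements of norm `c p ^ (2 m)` with
bounded `c` that are divisible by `p ^ (2 m)` in one of the two embeddings into `ℤ_p`; for two of
these that are congruent modulo `c`, the product of one and the conjugate of the other is
divisible by `c`. -/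
lemma exists_norm_eq_prime_pow {p : ℕ} [Fact p.Prime] {t n : ℤ} (htn : t ^ 2 - 4 * n < 0)
    {μ μ' : ℤ_[p]} (hadd : μ + μ' = t) (hmul : μ * μ' = n) :
    ∃ A B : ℤ, ∃ i j : ℕ, ∃ u v : ℤ_[p], j < i ∧ u * v = 1 ∧ A + B * μ = p ^ i * u ∧
      A + B * μ' = p ^ j * v ∧ A ^ 2 + t * A * B + n * B ^ 2 = p ^ (i + j) := by
  have hp : p.Prime := Fact.out
  have hp0 : (p : ℤ) ≠ 0 := by exact_mod_cast hp.ne_zero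
  have hpp : (p : ℤ_[p]) ≠ 0 := by exact_mod_cast hp.ne_zero
  choose a b hne ha hb hdvd using exists_small_dvd_add_mul μ
  have hnorm : ∀ a b : ℤ, ((a : ℤ_[p]) + b * μ) * (a + b * μ') =
      ((a ^ 2 + t * a * b + n * b ^ 2 : ℤ) : ℤ_[p]) := by
    intro a b
    push_cast
    rw [← hadd, ← hmul]
    ring
  have hc : ∀ m, ∃ c : ℤ, a m ^ 2 + t * a m * b m + n * b m ^ 2 = p ^ (2 * m) * c := by
    intro m
    have h1 : (p : ℤ_[p]) ^ (2 * m) ∣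
        ((a m ^ 2 + t * a m * b m + n * b m ^ 2 : ℤ) : ℤ_[p]) := by
      rw [← hnorm]
      exact (hdvd m).mul_right _
    exact (PadicInt.pow_p_dvd_int_iff _ _).1 h1
  choose c hc using hc
  obtain ⟨C, hC⟩ : ∃ C : ℕ, (C : ℤ) = 1 + |t| + |n| :=
    ⟨(1 + |t| + |n|).toNat, Int.toNat_of_nonneg (by positivity)⟩
  have hc1 : ∀ m, 1 ≤ c m ∧ c m ≤ C := by
    intro m
    have hq : (0 : ℤ) < p ^ (2 * m) := by positivity
    constructor
    · have h1 : 0 < a m ^ 2 + t * a m * b m + n * b m ^ 2 := by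
        by_cases hb0 : b m = 0
        · have ha0 : a m ≠ 0 := (hne m).resolve_right (not_not.2 hb0)
          simpa [hb0] using sq_pos_of_ne_zero ha0
        · nlinarith [sq_nonneg (2 * a m + t * b m), sq_pos_of_ne_zero hb0]
      rw [hc] at h1
      exact pos_of_mul_pos_right h1 hq.le
    · refine le_of_mul_le_mul_left ?_ hq
      rw [← hc, hC]
      have hq' : (p : ℤ) ^ (2 * m) = p ^ m * p ^ m := by ring
      have h1 : a m ^ 2 ≤ p ^ (2 * m) := by
        rw [← sq_abs, hq', sq]
        exact mul_le_mul (ha m) (ha m) (abs_nonneg _) (by positivity)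
      have h2 : t * a m * b m ≤ p ^ (2 * m) * |t| := by
        refine (le_abs_self _).trans ?_
        rw [mul_assoc, abs_mul, abs_mul, mul_comm, hq']
        exact mul_le_mul_of_nonneg_right
          (mul_le_mul (ha m) (hb m) (abs_nonneg _) (by positivity)) (abs_nonneg _)
      have h3 : n * b m ^ 2 ≤ p ^ (2 * m) * |n| := by
        refine (le_abs_self _).trans ?_
        rw [abs_mul, abs_pow, mul_comm, hq', sq]
        exact mul_le_mul_of_nonneg_right
          (mul_le_mul (hb m) (hb m) (abs_nonneg _) (by positivity)) (abs_nonneg _)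
      linarith
  have : NeZero C.factorial := ⟨C.factorial_ne_zero⟩
  obtain ⟨y, hy⟩ := Finite.exists_infinite_fiber
    fun m => ((⟨c m, Finset.mem_Icc.2 (hc1 m)⟩ : Finset.Icc (1 : ℤ) C),
      (a m : ZMod C.factorial), (b m : ZMod C.factorial))
  rw [Set.infinite_coe_iff] at hy
  obtain ⟨k, hk⟩ := hy.nonempty
  obtain ⟨l, hl, hkl⟩ := hy.exists_gt (k + C)
  have hlk := Set.mem_singleton_iff.1 hl
  rw [← Set.mem_singleton_iff.1 hk] at hlk
  simp only [Prod.mk.injEq, Subtype.mk.injEq] at hlk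
  obtain ⟨hcc, haa, hbb⟩ := hlk
  have hcC : c k ∣ (C.factorial : ℤ) := by
    rw [← Int.toNat_of_nonneg (zero_le_one.trans (hc1 k).1)]
    exact_mod_cast Nat.dvd_factorial (by have := (hc1 k).1; omega) (by have := (hc1 k).2; omega)
  obtain ⟨r, hr⟩ := hcC.trans ((ZMod.intCast_eq_intCast_iff_dvd_sub _ _ _).1 haa.symm)
  obtain ⟨s, hs⟩ := hcC.trans ((ZMod.intCast_eq_intCast_iff_dvd_sub _ _ _).1 hbb.symm)
  have hck := hc k
  have hcl := hc l
  rw [hcc] at hcl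
  have hcpos : 1 ≤ c k ∧ c k ≤ C := hc1 k
  have hdk := hdvd k
  have hdl := hdvd l
  generalize a k = a₁, b k = b₁, a l = a₂, b l = b₂, c k = γ at *
  -- `(a₂ + b₂ μ) (a₁ + b₁ μ')` divided by `γ`
  have hA : ∃ A : ℤ, γ * A = a₂ * a₁ + a₂ * b₁ * t + b₂ * b₁ * n :=
    ⟨p ^ (2 * k) + r * a₁ + r * b₁ * t + s * b₁ * n, by
      linear_combination -hck - (a₁ + b₁ * t) * hr - b₁ * n * hs⟩
  have hB : ∃ B : ℤ, γ * B = b₂ * a₁ - a₂ * b₁ :=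
    ⟨s * a₁ - r * b₁, by linear_combination b₁ * hr - a₁ * hs⟩
  obtain ⟨A, hA⟩ := hA
  obtain ⟨B, hB⟩ := hB
  have hA' := congrArg (Int.cast : ℤ → ℤ_[p]) hA
  have hB' := congrArg (Int.cast : ℤ → ℤ_[p]) hB
  push_cast at hA' hB'
  have hφ : (γ : ℤ_[p]) * (A + B * μ) = (a₂ + b₂ * μ) * (a₁ + b₁ * μ') := by
    linear_combination hA' + μ * hB' - a₂ * b₁ * hadd - b₂ * b₁ * hmul
  have hN : A ^ 2 + t * A * B + n * B ^ 2 = p ^ (2 * k + 2 * l) := by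
    have hγ0 : γ ^ 2 ≠ 0 := pow_ne_zero _ (by omega)
    refine mul_left_cancel₀ hγ0 ?_
    have : γ ^ 2 * (A ^ 2 + t * A * B + n * B ^ 2) =
      (γ * A) ^ 2 + t * (γ * A) * (γ * B) + n * (γ * B) ^ 2 := by ring
    rw [this, hA, hB, pow_add]
    linear_combination (a₂ ^ 2 + t * a₂ * b₂ + n * b₂ ^ 2) * hck + p ^ (2 * k) * γ * hcl
  have hNp := hnorm A B
  rw [hN] at hNp
  push_cast at hNp
  obtain ⟨i, hi, hass⟩ := (dvd_prime_pow PadicInt.prime_p _).1 (Dvd.intro _ hNp)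
  obtain ⟨u, hu⟩ := hass.symm
  have hu' : A + B * μ = p ^ i * (u : ℤ_[p]) := hu.symm
  have hil : k + l < i := by
    by_contra h
    have h1 : (p : ℤ_[p]) ^ (2 * l) ∣ γ * (p ^ i * u) := by
      rw [← hu', hφ]
      exact hdl.mul_right _
    have h2 : (p : ℤ_[p]) ^ (l - k) ∣ γ := by
      have h3 : (p : ℤ_[p]) ^ i * p ^ (l - k) ∣ p ^ i * γ := by
        rw [← pow_add]
        refine (pow_dvd_pow (p : ℤ_[p]) (by omega : i + (l - k) ≤ 2 * l)).trans
          ((Units.dvd_mul_right (u := u)).1 ?_)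
        convert h1 using 1
        ring
      exact (mul_dvd_mul_iff_left (pow_ne_zero _ hpp)).1 h3
    have h4 := Int.le_of_dvd (by omega) ((PadicInt.pow_p_dvd_int_iff _ _).1 h2)
    have h5 : l - k < p ^ (l - k) := Nat.lt_pow_self hp.one_lt
    have h6 : ((l - k : ℕ) : ℤ) < p ^ (l - k) := by exact_mod_cast h5
    omega
  refine ⟨A, B, i, 2 * k + 2 * l - i, u, (u⁻¹ : ℤ_[p]ˣ), by omega, by simp, hu', ?_, ?_⟩
  · refine mul_left_cancel₀ (mul_ne_zero (pow_ne_zero i hpp) u.ne_zero) ?_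
    rw [← hu', hNp, hu']
    have : (p : ℤ_[p]) ^ i * u * (p ^ (2 * k + 2 * l - i) * (u⁻¹ : ℤ_[p]ˣ)) =
      p ^ i * p ^ (2 * k + 2 * l - i) * (u * (u⁻¹ : ℤ_[p]ˣ)) := by ring
    rw [this, ← pow_add, Nat.add_sub_cancel' hi]
    simp
  · rw [hN, Nat.add_sub_cancel' hi]

/-! ### Strong approximation at `p` -/

namespace ShimuraDatum

variable {p : ℕ} [Fact p.Prime] (D : ShimuraDatum p)

lemma exists_intNrd_add_mul (y w : D.R) : ∃ b : ℤ, ∀ m : ℤ,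
    D.intNrd (y + (m : D.R) * w) = D.intNrd w * m ^ 2 + b * m + D.intNrd y := by
  refine ⟨D.intTrd (y * D.conj w), fun m => ?_⟩
  have h : (D.intNrd (y + (m : D.R) * w) : ℚ) =
      D.intNrd w * m ^ 2 + D.intTrd (y * D.conj w) * m + D.intNrd y := by
    simp only [coe_intNrd, coe_intTrd, nrd, Subring.coe_add, Subring.coe_mul, Subring.coe_intCast,
      coe_conj]
    simp
    ring
  exact_mod_cast h

lemma intTrd_intCast_mul (m : ℤ) (w : D.R) : D.intTrd ((m : D.R) * w) = m * D.intTrd w := by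
  have h : (D.intTrd ((m : D.R) * w) : ℚ) = m * D.intTrd w := by
    simp only [coe_intTrd, Subring.coe_mul, Subring.coe_intCast]
    simp
    ring
  exact_mod_cast h

lemma reduction_add_mul (y w : D.R) (m : ℤ) :
    D.reduction (y + ((p * m : ℤ) : D.R) * w) = D.reduction y := by
  rw [map_add, map_mul, map_intCast, intCast_matrix_mul]
  simp

/-- An element that generates an imaginary quadratic order split at `p`. -/
lemma exists_imaginary : ∃ x : D.R, D.reduction x = !![1, 0; 0, 0] ∧
    D.intTrd x ^ 2 - 4 * D.intNrd x < 0 := by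
  obtain ⟨y, hy⟩ := D.reduction_surjective !![1, 0; 0, 0]
  obtain ⟨w, hw, hw'⟩ := D.exists_pure_nrd_pos
  obtain ⟨b, hb⟩ := D.exists_intNrd_add_mul y w
  have hp : (0 : ℤ) < p := by exact_mod_cast (Fact.out : p.Prime).pos
  obtain ⟨N, hN⟩ := exists_quadratic_gt (a := D.intNrd w * p ^ 2) (by positivity) (b * p)
    (D.intNrd y) (D.intTrd y ^ 2)
  refine ⟨y + ((p * N : ℤ) : D.R) * w, by rw [reduction_add_mul, hy], ?_⟩
  rw [hb, intTrd_add, intTrd_intCast_mul, hw]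
  nlinarith [sq_nonneg (D.intTrd y)]

/-- A pure quaternion in the order that generates a real quadratic algebra, with prescribed
reduction. If `ν` is not a square, then this algebra is a field, inert at `p`. -/
lemma exists_real (hp : p ≠ 2) (ν : ZMod p) : ∃ x : D.R, D.reduction x = !![0, 1; ν, 0] ∧
    D.intTrd x = 0 ∧ D.intNrd x < 0 := by
  have h2 : (2 : ZMod p) ≠ 0 := by
    intro h
    have : p ∣ 2 := (ZMod.natCast_eq_zero_iff 2 p).1 (by exact_mod_cast h)
    exact hp ((Nat.prime_dvd_prime_iff_eq Fact.out Nat.prime_two).1 this)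
  obtain ⟨y, hy⟩ := D.reduction_surjective !![0, 1 / 2; ν / 2, 0]
  have hy0 : D.intTrd (y - D.conj y) = 0 := by
    have : (D.intTrd (y - D.conj y) : ℚ) = 0 := by
      simp [coe_intTrd]
    exact_mod_cast this
  have hy' : D.reduction (y - D.conj y) = !![0, 1; ν, 0] := by
    rw [map_sub, reduction_conj, hy, Matrix.adjugate_fin_two]
    ext i j
    have h3 : ∀ s : ZMod p, s / 2 + s / 2 = s := fun s => by field_simp; ring
    fin_cases i <;> fin_cases j <;> simp [h3]
    simpa using h3 1
  obtain ⟨w, hw, hw'⟩ := D.exists_pure_nrd_neg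
  obtain ⟨b, hb⟩ := D.exists_intNrd_add_mul (y - D.conj y) w
  have hp : (0 : ℤ) < p := by exact_mod_cast (Fact.out : p.Prime).pos
  obtain ⟨N, hN⟩ := exists_quadratic_gt (a := -D.intNrd w * p ^ 2) (by nlinarith [pow_pos hp 2])
    (-b * p) (-D.intNrd (y - D.conj y)) 0
  refine ⟨y - D.conj y + ((p * N : ℤ) : D.R) * w, by rw [reduction_add_mul, hy'], ?_, ?_⟩
  · rw [intTrd_add, intTrd_intCast_mul, hw, hy0, mul_zero, add_zero]
  · rw [hb]
    nlinarith

lemma toZMod_eq_zero_iff {z : ℤ_[p]} : PadicInt.toZMod z = 0 ↔ ¬ IsUnit z := by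
  rw [← RingHom.mem_ker, PadicInt.ker_toZMod, IsLocalRing.mem_maximalIdeal, mem_nonunits_iff]

/-- Hensel's lemma for a polynomial `X ^ 2 - t X + n` that is congruent to `X (X - 1)`. -/
lemma exists_root_toZMod_eq_zero {t n : ℤ} (ht : (t : ZMod p) = 1) (hn : (n : ZMod p) = 0) :
    ∃ μ : ℤ_[p], μ * μ - t * μ + n = 0 ∧ PadicInt.toZMod μ = 0 := by
  have ht' : ‖(t : ℤ_[p])‖ = 1 := by
    rw [← PadicInt.isUnit_iff, ← not_not (a := IsUnit _), ← toZMod_eq_zero_iff, map_intCast, ht]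
    exact one_ne_zero
  have hn' : ‖(n : ℤ_[p])‖ < 1 := by
    rw [← PadicInt.not_isUnit_iff, ← toZMod_eq_zero_iff, map_intCast, hn]
  let F : Polynomial ℤ_[p] :=
    Polynomial.X * Polynomial.X - Polynomial.C (t : ℤ_[p]) * Polynomial.X + Polynomial.C (n : ℤ_[p])
  have hF : F.aeval (0 : ℤ_[p]) = n := by simp [F]
  have hF' : ‖F.derivative.aeval (0 : ℤ_[p])‖ = 1 := by simpa [F] using ht'
  obtain ⟨μ, hμ, hμ0, -⟩ := hensels_lemma (F := F) (a := 0) (by rwa [hF, hF', one_pow])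
  refine ⟨μ, by simpa [F] using hμ, ?_⟩
  rw [toZMod_eq_zero_iff, PadicInt.not_isUnit_iff]
  rwa [hF', sub_zero] at hμ0

section idempotents

variable {A : Type*} [CommRing A] {M : Type*} [Ring M] [Algebra A M] {e f : M}

lemma smul_add_smul_pow (he : e * e = e) (hf : f * f = f) (hef : e * f = 0) (hfe : f * e = 0)
    (h1 : e + f = 1) (s r : A) (n : ℕ) : (s • e + r • f) ^ n = s ^ n • e + r ^ n • f := by
  induction n with
  | zero => simp [h1]
  | succ n ih =>
    rw [pow_succ, ih]
    simp [add_mul, mul_add, smul_smul, he, hf, hef, hfe, pow_succ, mul_comm]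

lemma smul_add_smul_conj (he : e * e = e) (hf : f * f = f) (hef : e * f = 0) (hfe : f * e = 0)
    (h1 : e + f = 1) (s r a b : A) (X : M) :
    (s • e + r • f) * (a • (1 : M) + b • X) * (r • e + s • f) =
      (s * r) • (a • (1 : M) + b • (e * X * e + f * X * f)) + (b * s ^ 2) • (e * X * f) +
        (b * r ^ 2) • (f * X * e) := by
  rw [← h1]
  simp only [add_mul, mul_add, smul_mul_assoc, mul_smul_comm, smul_smul, smul_add, he, hf, hef, hfe,
    ← mul_assoc, smul_zero, add_zero, zero_add]
  module

end idempotents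

/-- The element `α ^ n (a + b x₀) α' ^ n` of the order is divisible by a power of `p`, and the
quotient is an element of norm one whose reduction is a transvection: conjugation by `α`
multiplies one of the off-diagonal blocks with respect to the idempotents `e`, `f` by
`p ^ (-d)`, up to a unit, and the other one by `p ^ d`. -/
lemma exists_transvection {e f : Matrix (Fin 2) (Fin 2) ℤ_[p]} (he : e * e = e) (hf : f * f = f)
    (hef : e * f = 0) (hfe : f * e = 0) (h1 : e + f = 1) {j d n : ℕ} (hd : 0 < d) (hn : 0 < n)
    {u v : ℤ_[p]} (huv : u * v = 1) {α α' : D.R}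
    (hα : D.ιp α = (p ^ j * v) • e + (p ^ (j + d) * u) • f)
    (hα' : D.ιp α' = (p ^ (j + d) * u) • e + (p ^ j * v) • f)
    (hN : D.intNrd α = p ^ (j + d + j)) (hN' : D.intNrd α' = p ^ (j + d + j))
    {x₀ : D.R} (htr : D.intTrd x₀ = 0) {a b : ℤ}
    (hab : a ^ 2 - -D.intNrd x₀ * (p ^ (d * n) * b) ^ 2 = 1) (ha : (p : ℤ) ∣ a - 1)
    (hb : ¬ (p : ℤ) ∣ b) :
    ∃ z : D.R, D.intNrd z = 1 ∧ ∃ c : ZMod p, c ≠ 0 ∧ D.reduction z =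
      1 + c • (redMatrix p e * D.reduction x₀ * redMatrix p f) := by
  have hp : p.Prime := Fact.out
  have hp0 : (p : ℤ) ≠ 0 := by exact_mod_cast hp.ne_zero
  set g : D.R := (a : D.R) + ((p ^ (d * n) * b : ℤ) : D.R) * x₀ with hg
  have hgn : D.intNrd g = 1 := by
    rw [hg, intNrd_add_mul_intCast, htr, ← hab]
    ring
  have hgp : D.ιp g = (a : ℤ_[p]) • (1 : Matrix (Fin 2) (Fin 2) ℤ_[p]) +
      ((p : ℤ_[p]) ^ (d * n) * b) • D.ιp x₀ := by
    rw [hg, map_add, map_mul, map_intCast, map_intCast, intCast_matrix_mul,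
      ← mul_one ((a : ℤ) : Matrix (Fin 2) (Fin 2) ℤ_[p]), intCast_matrix_mul]
    push_cast
    rfl
  -- the unit `b * v ^ (2 * n)` is the coefficient of the expanded block
  let W : Matrix (Fin 2) (Fin 2) ℤ_[p] := (a : ℤ_[p]) • (1 : Matrix (Fin 2) (Fin 2) ℤ_[p]) +
    ((p : ℤ_[p]) ^ (d * n) * b) • (e * D.ιp x₀ * e + f * D.ιp x₀ * f) +
    (b * v ^ (2 * n)) • (e * D.ιp x₀ * f) +
    ((p : ℤ_[p]) ^ (2 * (d * n)) * b * u ^ (2 * n)) • (f * D.ιp x₀ * e)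
  have huvn : u ^ n * v ^ n = 1 := by rw [← mul_pow, huv, one_pow]
  have hy : D.ιp (α ^ n * g * α' ^ n) = (p : ℤ_[p]) ^ ((j + d + j) * n) • W := by
    rw [map_mul, map_mul, map_pow, map_pow, hα, hα', hgp,
      smul_add_smul_pow he hf hef hfe h1, smul_add_smul_pow he hf hef hfe h1,
      smul_add_smul_conj he hf hef hfe h1]
    simp only [W, smul_add, smul_smul]
    congr 1
    · congr 1
      · congr 1
        · congr 1
          linear_combination (p : ℤ_[p]) ^ ((j + d + j) * n) * a * huvn
        · have : (p ^ j * v) ^ n * (p ^ (j + d) * u) ^ n * ((p : ℤ_[p]) ^ (d * n) * b) =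
              p ^ ((j + d + j) * n) * (p ^ (d * n) * b) := by
            linear_combination (p : ℤ_[p]) ^ ((j + d + j) * n) * (p ^ (d * n) * b) * huvn
          rw [this]
      · congr 1
        ring
    · congr 1
      ring
  obtain ⟨z, hz, hzW⟩ := D.exists_eq_p_pow_mul hy
  refine ⟨z, ?_, PadicInt.toZMod (b * v ^ (2 * n) : ℤ_[p]), ?_, ?_⟩
  · have h2 := congrArg D.intNrd hz
    have h3 : ∀ (x : D.R) (k : ℕ), D.intNrd (x ^ k) = D.intNrd x ^ k := by
      intro x k
      induction k with
      | zero => simpa using D.intNrd_intCast 1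
      | succ k ih => rw [pow_succ, pow_succ, intNrd_mul, ih]
    have h4 : D.intNrd (p : D.R) = p ^ 2 := by simpa using D.intNrd_intCast p
    rw [intNrd_mul, intNrd_mul, intNrd_mul, h3, h3, h3, hN, hN', hgn, h4] at h2
    refine mul_left_cancel₀ (pow_ne_zero ((j + d + j) * n * 2) hp0) ?_
    rw [mul_one, pow_mul', ← h2]
    ring
  · rw [map_mul, map_intCast, map_pow]
    refine mul_ne_zero ?_ (pow_ne_zero _ ?_)
    · rwa [Ne, ZMod.intCast_zmod_eq_zero_iff_dvd]
    · intro h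
      have := congrArg (PadicInt.toZMod (p := p)) huv
      rw [map_mul, h, mul_zero, map_one] at this
      exact zero_ne_one this
  · have ha1 : ((a : ℤ) : ZMod p) = 1 := by
      have := (ZMod.intCast_zmod_eq_zero_iff_dvd _ _).2 ha
      push_cast at this
      exact sub_eq_zero.1 this
    have hdn : d * n ≠ 0 := by positivity
    rw [reduction_apply, hzW]
    simp only [W, map_add, redMatrix_smul, map_mul, map_pow, map_intCast, map_natCast, ha1, map_one,
      CharP.cast_eq_zero, zero_pow hdn, zero_pow (mul_ne_zero two_ne_zero hdn), zero_mul, zero_smul,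
      add_zero, one_smul, reduction_apply]

/-- A subset of `M₂` that is closed under multiplication and contains nontrivial upper and lower
transvections over the prime field contains `SL₂`. -/
lemma mem_of_det_eq_one {H : Submonoid (Matrix (Fin 2) (Fin 2) (ZMod p))} {c c' : ZMod p}
    (hc : c ≠ 0) (hc' : c' ≠ 0) (h : !![1, c; 0, 1] ∈ H) (h' : !![1, 0; c', 1] ∈ H)
    {A : Matrix (Fin 2) (Fin 2) (ZMod p)} (hA : A.det = 1) : A ∈ H := by
  have hpow : ∀ (s : ZMod p) (n : ℕ), !![1, s; 0, 1] ^ n = !![1, n * s; 0, 1] := by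
    intro s n
    induction n with
    | zero => simp [Matrix.one_fin_two]
    | succ n ih =>
      rw [pow_succ, ih]
      simp [add_mul, add_comm]
  have hpow' : ∀ (s : ZMod p) (n : ℕ), !![1, 0; s, 1] ^ n = !![1, 0; n * s, 1] := by
    intro s n
    induction n with
    | zero => simp [Matrix.one_fin_two]
    | succ n ih =>
      rw [pow_succ, ih]
      simp [add_mul]
  have hup : ∀ s : ZMod p, !![1, s; 0, 1] ∈ H := by
    intro s
    have := H.pow_mem h (s / c).val
    rwa [hpow, ZMod.natCast_val, ZMod.cast_id, div_mul_cancel₀ _ hc] at this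
  have hlow : ∀ s : ZMod p, !![1, 0; s, 1] ∈ H := by
    intro s
    have := H.pow_mem h' (s / c').val
    rwa [hpow', ZMod.natCast_val, ZMod.cast_id, div_mul_cancel₀ _ hc'] at this
  have key : ∀ B : Matrix (Fin 2) (Fin 2) (ZMod p), B.det = 1 → B 1 0 ≠ 0 → B ∈ H := by
    intro B hB h0
    rw [Matrix.det_fin_two] at hB
    have : B = !![1, (B 0 0 - 1) / B 1 0; 0, 1] * !![1, 0; B 1 0, 1] *
        !![1, (B 1 1 - 1) / B 1 0; 0, 1] := by
      rw [Matrix.mul_fin_two, Matrix.mul_fin_two, Matrix.eta_fin_two B]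
      ext i j
      fin_cases i <;> fin_cases j <;> simp <;> field_simp
      · ring
      · linear_combination -hB
      · ring
    rw [this]
    exact H.mul_mem (H.mul_mem (hup _) (hlow _)) (hup _)
  by_cases h0 : A 1 0 = 0
  · have h00 : A 0 0 ≠ 0 := by
      intro h
      rw [Matrix.det_fin_two, h, h0] at hA
      simp at hA
    have h1 : !![1, 0; 1, 1] * A ∈ H := by
      refine key _ ?_ ?_
      · rw [Matrix.det_mul, hA]
        simp [Matrix.det_fin_two]
      · simpa [Matrix.mul_apply, Fin.sum_univ_two, h0] using h00
    have h2 := H.mul_mem (hlow (-1)) h1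
    rwa [← mul_assoc, Matrix.mul_fin_two, show !![(1 : ZMod p) * 1 + 0 * 1, 1 * 0 + 0 * 1;
      -1 * 1 + 1 * 1, -1 * 0 + 1 * 1] = 1 by simp [Matrix.one_fin_two], one_mul] at h2
  · exact key A hA h0

/-- The reductions of the elements of norm one. -/
def reductionNormOne : Submonoid (Matrix (Fin 2) (Fin 2) (ZMod p)) where
  carrier := {A | ∃ z : D.R, D.intNrd z = 1 ∧ D.reduction z = A}
  one_mem' := ⟨1, by simpa using D.intNrd_intCast 1, map_one _⟩
  mul_mem' := by
    rintro _ _ ⟨y, hy, rfl⟩ ⟨z, hz, rfl⟩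
    exact ⟨y * z, by rw [intNrd_mul, hy, hz, one_mul], map_mul _ _ _⟩

/-- Strong approximation: the elements of norm one of the order surject onto `SL₂(𝔽_p)`. -/
theorem exists_reduction_eq (hp : p ≠ 2) {ε : ZMod p} (hε : ¬ IsSquare ε)
    {A : Matrix (Fin 2) (Fin 2) (ZMod p)} (hA : A.det = 1) :
    ∃ z : D.R, D.intNrd z = 1 ∧ D.reduction z = A := by
  have hpr : p.Prime := Fact.out
  have hpz : (0 : ℤ) < p := by exact_mod_cast hpr.pos
  obtain ⟨x, hx, hdisc⟩ := D.exists_imaginary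
  obtain ⟨x₀, hx₀, htr, hneg⟩ := D.exists_real hp ε
  have ht : (D.intTrd x : ZMod p) = 1 := by
    rw [← trace_reduction, hx]
    simp [Matrix.trace_fin_two]
  have hn : (D.intNrd x : ZMod p) = 0 := by
    rw [← det_reduction, hx]
    simp [Matrix.det_fin_two]
  -- the root in `p ℤ_p` of the characteristic polynomial of `x`
  obtain ⟨μ, hμ, hμ0⟩ : ∃ μ : ℤ_[p], μ * μ - D.intTrd x * μ + D.intNrd x = 0 ∧
      PadicInt.toZMod μ = 0 :=
    exists_root_toZMod_eq_zero ht hn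
  set μ' : ℤ_[p] := D.intTrd x - μ with hμ'
  have hadd : μ + μ' = D.intTrd x := by rw [hμ']; ring
  have hmul : μ * μ' = D.intNrd x := by rw [hμ']; linear_combination -hμ
  have hμ1 : PadicInt.toZMod μ' = 1 := by rw [hμ', map_sub, hμ0, map_intCast, ht, sub_zero]
  obtain ⟨w, hw⟩ : ∃ w, (μ' - μ) * w = 1 := by
    rw [← isUnit_iff_exists_inv, ← not_not (a := IsUnit _), ← toZMod_eq_zero_iff, map_sub, hμ0, hμ1,
      sub_zero]
    exact one_ne_zero
  have hw1 : PadicInt.toZMod w = 1 := by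
    have := congrArg (PadicInt.toZMod (p := p)) hw
    rwa [map_mul, map_sub, hμ0, hμ1, sub_zero, one_mul, map_one] at this
  set X := D.ιp x with hX
  have hXX : X * X = (μ + μ') • X - (μ * μ') • (1 : Matrix (Fin 2) (Fin 2) ℤ_[p]) := by
    rw [hadd, hmul, hX, ιp_sq]
  -- the projections to the eigenlines of `x` over `ℤ_p`
  let e := w • (X - μ • (1 : Matrix (Fin 2) (Fin 2) ℤ_[p]))
  let f := w • (μ' • (1 : Matrix (Fin 2) (Fin 2) ℤ_[p]) - X)
  have h1 : e + f = 1 := by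
    simp only [e, f]
    linear_combination (norm := module) hw • (1 : Matrix (Fin 2) (Fin 2) ℤ_[p])
  have hef : e * f = 0 := by
    simp only [e, f, smul_mul_assoc, mul_smul_comm, sub_mul, mul_sub, one_mul, mul_one]
    linear_combination (norm := module) -(w * w) • hXX
  have hfe : f * e = 0 := by
    simp only [e, f, smul_mul_assoc, mul_smul_comm, sub_mul, mul_sub, one_mul, mul_one]
    linear_combination (norm := module) -(w * w) • hXX
  have he : e * e = e := by
    have := congrArg (e * ·) h1
    simpa [mul_add, hef] using this
  have hf : f * f = f := by
    have := congrArg (f * ·) h1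
    simpa [mul_add, hfe] using this
  have hre : redMatrix p e = !![1, 0; 0, 0] := by
    simp only [e, redMatrix_smul, map_sub, hw1, hμ0, zero_smul, sub_zero, one_smul]
    exact hx
  have hrf : redMatrix p f = !![0, 0; 0, 1] := by
    have := congrArg (redMatrix p) h1
    rw [map_add, hre, map_one] at this
    rw [eq_sub_of_add_eq' this, Matrix.one_fin_two]
    ext i j
    fin_cases i <;> fin_cases j <;> simp
  obtain ⟨A', B, i, j, u, v, hij, huv, hu, hv, hN⟩ := exists_norm_eq_prime_pow hdisc hadd hmul
  obtain ⟨d, rfl⟩ : ∃ d, i = j + d := ⟨i - j, by omega⟩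
  set β : D.R := (A' : D.R) + (B : D.R) * x with hβ
  have hXef : X = μ' • e + μ • f := by
    simp only [e, f]
    linear_combination (norm := module) -hw • X
  have hβp : D.ιp β = (p ^ j * v) • e + (p ^ (j + d) * u) • f := by
    rw [hβ, map_add, map_mul, map_intCast, map_intCast, intCast_matrix_mul,
      ← mul_one ((A' : ℤ) : Matrix (Fin 2) (Fin 2) ℤ_[p]), intCast_matrix_mul, ← h1, ← hX, hXef,
      ← hu, ← hv]
    module
  have hβp' : D.ιp (D.conj β) = (p ^ (j + d) * u) • e + (p ^ j * v) • f := by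
    rw [hβ, conj_add_mul_intCast, conj_eq, map_add, map_mul, map_sub, map_intCast, map_intCast,
      map_intCast, intCast_matrix_mul, ← mul_one ((A' : ℤ) : Matrix (Fin 2) (Fin 2) ℤ_[p]),
      ← mul_one ((D.intTrd x : ℤ) : Matrix (Fin 2) (Fin 2) ℤ_[p]), intCast_matrix_mul,
      intCast_matrix_mul, ← h1, ← hX, hXef, ← hu, ← hv, ← hadd]
    module
  have hβN : D.intNrd β = p ^ (j + d + j) := by
    rw [hβ, intNrd_add_mul_intCast, hN]
  have hβN' : D.intNrd (D.conj β) = p ^ (j + d + j) := by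
    have : (D.intNrd (D.conj β) : ℚ) = D.intNrd β := by
      rw [coe_intNrd, coe_intNrd]
      simp [nrd]
    rw [← hβN]
    exact_mod_cast this
  have hsq : ¬ IsSquare (-D.intNrd x₀) := by
    rintro ⟨r, hr⟩
    have h := D.det_reduction x₀
    rw [hx₀, Matrix.det_fin_two] at h
    refine hε ⟨r, ?_⟩
    have h' := congrArg (Int.cast : ℤ → ZMod p) hr
    push_cast at h'
    rw [← h', ← h]
    simp
  obtain ⟨v₀, hv₀⟩ := exists_pell_valuation hpr (neg_pos.2 hneg) hsq
  -- this valuation is a multiple of `d`, as `β ^ (v₀ + 1)` shifts valuations by `d * (v₀ + 1)`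
  obtain ⟨a, b, hab, ha, hb⟩ := hv₀ (d * (v₀ + 1)) (by nlinarith)
  obtain ⟨y, hy, c, hc, hyc⟩ := D.exists_transvection he hf hef hfe h1 (by omega : 0 < d)
    v₀.succ_pos huv hβp hβp' hβN hβN' htr hab ha hb
  obtain ⟨z, hz, c', hc', hzc⟩ := D.exists_transvection hf he hfe hef
    ((add_comm f e).trans h1) (by omega : 0 < d) v₀.succ_pos huv
    (hβp'.trans (add_comm _ _)) (hβp.trans (add_comm _ _)) hβN' hβN htr hab ha hb
  rw [hre, hrf, hx₀] at hyc hzc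
  have hε0 : ε ≠ 0 := by
    rintro rfl
    exact hε (IsSquare.zero)
  refine mem_of_det_eq_one (H := D.reductionNormOne) hc (mul_ne_zero hc' hε0)
    ⟨y, hy, hyc.trans ?_⟩ ⟨z, hz, hzc.trans ?_⟩ hA
  · simp [Matrix.one_fin_two]
  · simp [Matrix.one_fin_two]

end ShimuraDatum

/-! ### Hecke operators and level structures at `p` -/

namespace ShimuraDatum

variable {p : ℕ} [Fact p.Prime] (D : ShimuraDatum p)

/-- A submonoid of a finite monoid contains the inverses of its invertible elements. -/
lemma exists_mul_eq_one_of_mem {U : Submonoid (Matrix (Fin 2) (Fin 2) (ZMod p))}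
    {X : Matrix (Fin 2) (Fin 2) (ZMod p)} (hX : X ∈ U) (hdet : X.det ≠ 0) :
    ∃ Y ∈ U, X * Y = 1 ∧ Y * X = 1 := by
  obtain ⟨u, rfl⟩ := (Matrix.isUnit_iff_isUnit_det X).2 (isUnit_iff_ne_zero.2 hdet)
  have h : u ^ (orderOf u - 1) = u⁻¹ := by
    rw [← mul_eq_one_iff_eq_inv, ← pow_succ, Nat.sub_add_cancel (orderOf_pos u), pow_orderOf_eq_one]
  refine ⟨(u⁻¹ : (Matrix (Fin 2) (Fin 2) (ZMod p))ˣ), ?_, by simp, by simp⟩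
  rw [← h, Units.val_pow_eq_pow_val]
  exact U.pow_mem hX _

lemma det_reduction_ne_zero {n : ℕ} (hpn : ¬ p ∣ n) {x : D.R} (hx : D.nrd x = n) :
    (D.reduction x).det ≠ 0 := by
  have h : D.intNrd x = n := by
    rw [← coe_intNrd] at hx
    exact_mod_cast hx
  rw [det_reduction, h, Int.cast_natCast, Ne, ZMod.natCast_eq_zero_iff]
  exact hpn

variable {U U' V : Submonoid (Matrix (Fin 2) (Fin 2) (ZMod p))} {n : ℕ} (hn : 0 < n)

/-- By strong approximation, if `U ∩ U'` contains an element of determinant `n`, then every coset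
`Γ α` of elements of norm `n` and level `U` has a representative that is also of level `U'`. -/
lemma exists_mul_mem_hecke (hp : p ≠ 2) {ε : ZMod p} (hε : ¬ IsSquare ε) (hpn : ¬ p ∣ n)
    {A : Matrix (Fin 2) (Fin 2) (ZMod p)} (hA : A.det = n) (hAU : A ∈ U) (hAU' : A ∈ U')
    {α : GL (Fin 2) ℝ} (hα : α ∈ (D.hecke U n hn).carrier) :
    ∃ γ ∈ D.Gamma U, γ * α ∈ (D.hecke U n hn).carrier ∧ γ * α ∈ (D.hecke U' n hn).carrier := by
  obtain ⟨x, hx, hxU, hxα⟩ := hα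
  obtain ⟨Y, hY, -, hYX⟩ := exists_mul_eq_one_of_mem hxU (D.det_reduction_ne_zero hpn hx)
  have hdet : (A * Y).det = 1 := by
    have h1 := congrArg Matrix.det hYX
    have h2 : (D.reduction x).det = n := by
      have h : D.intNrd x = n := by
        rw [← coe_intNrd] at hx
        exact_mod_cast hx
      rw [det_reduction, h, Int.cast_natCast]
    rw [Matrix.det_mul, h2, Matrix.det_one] at h1
    rw [Matrix.det_mul, hA, mul_comm, h1]
  obtain ⟨z, hz, hzA⟩ := D.exists_reduction_eq hp hε hdet
  have hz1 : D.nrd z = 1 := by rw [← coe_intNrd, hz, Int.cast_one]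
  have hzdet : (D.ιinf z).det ≠ 0 := by
    rw [det_ιinf, hz1]
    simp
  have hnrd : D.nrd ((z * x : D.R) : D.B) = n := by rw [Subring.coe_mul, nrd_mul, hz1, hx, one_mul]
  have hred : D.reduction (z * x) = A := by rw [map_mul, hzA, mul_assoc, hYX, mul_one]
  have hval : D.ιinf ((z * x : D.R) : D.B) =
      (Matrix.GeneralLinearGroup.mkOfDetNeZero _ hzdet * α).val := by
    rw [Subring.coe_mul, map_mul, hxα]
    rfl
  exact ⟨Matrix.GeneralLinearGroup.mkOfDetNeZero _ hzdet,
    ⟨z, hz1, hzA ▸ U.mul_mem hAU hY, rfl⟩,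
    ⟨z * x, hnrd, hred ▸ hAU, hval⟩, ⟨z * x, hnrd, hred ▸ hAU', hval⟩⟩

lemma mem_Gamma_of_mul_mem (hpn : ¬ p ∣ n) {γ α : GL (Fin 2) ℝ} (hγ : γ ∈ D.Gamma V)
    (hα : α ∈ (D.hecke U n hn).carrier) (h : γ * α ∈ (D.hecke U n hn).carrier) :
    γ ∈ D.Gamma U := by
  obtain ⟨z, hz, -, hzγ⟩ := hγ
  obtain ⟨x, hx, hxU, hxα⟩ := hα
  obtain ⟨y, -, hyU, hyα⟩ := h
  have hzx : z * x = y := Subtype.ext (D.ιinf_injective (by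
    rw [Subring.coe_mul, map_mul, hzγ, hxα, hyα]
    rfl))
  obtain ⟨Y, hY, hXY, -⟩ := exists_mul_eq_one_of_mem hxU (D.det_reduction_ne_zero hpn hx)
  refine ⟨z, hz, ?_, hzγ⟩
  have : D.reduction z = D.reduction y * Y := by
    rw [← hzx, map_mul, mul_assoc, hXY, mul_one]
  rw [this]
  exact U.mul_mem hyU hY

lemma mem_Gamma_of_mul_mem_right (hpn : ¬ p ∣ n) {γ α : GL (Fin 2) ℝ} (hγ : γ ∈ D.Gamma V)
    (hα : α ∈ (D.hecke U n hn).carrier) (h : α * γ ∈ (D.hecke U n hn).carrier) :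
    γ ∈ D.Gamma U := by
  obtain ⟨z, hz, -, hzγ⟩ := hγ
  obtain ⟨x, hx, hxU, hxα⟩ := hα
  obtain ⟨y, -, hyU, hyα⟩ := h
  have hzx : x * z = y := Subtype.ext (D.ιinf_injective (by
    rw [Subring.coe_mul, map_mul, hzγ, hxα, hyα]
    rfl))
  obtain ⟨Y, hY, -, hYX⟩ := exists_mul_eq_one_of_mem hxU (D.det_reduction_ne_zero hpn hx)
  refine ⟨z, hz, ?_, hzγ⟩
  have : D.reduction z = Y * D.reduction y := by
    rw [← hzx, map_mul, ← mul_assoc, hYX, one_mul]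
  rw [this]
  exact U.mul_mem hY hyU

/-- The double coset of two levels whose intersection contains an element of determinant `n`
commutes with `T_n`. -/
theorem doubleCoset_comm_T (hp : p ≠ 2) {ε : ZMod p} (hε : ¬ IsSquare ε) (hpn : ¬ p ∣ n)
    (hA : ∃ A ∈ U, A ∈ U' ∧ A.det = n) :
    (D.doubleCoset U U').onJacobian.comp (D.T U' n hn) =
      (D.T U n hn).comp (D.doubleCoset U U').onJacobian := by
  obtain ⟨A, hAU, hAU', hA⟩ := hA
  refine HeckeCorrespondence.onJacobian_comm _ _ _ fun f =>
    HeckeCorrespondence.onForms_comm _ _ _ (fun α => ?_) (fun α hα => ?_) (fun α hα => ?_)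
      (fun γ hγ α hα h => ?_) (fun γ hγ α hα h => ?_) (fun γ hγ α hα h => ?_) f
  · simp [doubleCoset]
  · exact D.exists_mul_mem_hecke hn hp hε hpn hA hAU hAU' hα
  · obtain ⟨γ, hγ, h, h'⟩ := D.exists_mul_mem_hecke hn hp hε hpn hA hAU' hAU hα
    exact ⟨γ, hγ, h', h⟩
  · exact D.mem_Gamma_of_mul_mem hn hpn hγ hα.2 h.2
  · exact D.mem_Gamma_of_mul_mem hn hpn hγ hα.1 h.1
  · exact D.mem_Gamma_of_mul_mem_right hn hpn hγ hα.1 h.1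

end ShimuraDatum

/-- The square classes of `𝔽_p` are represented by `1` and `ε`, hence the determinants of the
scalar matrices and of the antidiagonal matrices in `M_{ns+}` exhaust the nonzero elements. -/
lemma exists_mem_cartanSPlus_mem_cartanNsPlus {p : ℕ} [Fact p.Prime] {ε : ZMod p}
    (hε : ¬ IsSquare ε) {d : ZMod p} (hd : d ≠ 0) :
    ∃ A ∈ cartanSPlus p, A ∈ cartanNsPlus p ε ∧ A.det = d := by
  by_cases hsq : IsSquare d
  · obtain ⟨s, rfl⟩ := hsq
    exact ⟨!![s, 0; 0, s], Or.inl ⟨rfl, rfl⟩, Or.inl ⟨rfl, by simp⟩, by simp [Matrix.det_fin_two]⟩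
  · have hε0 : ε ≠ 0 := by
      rintro rfl
      exact hε IsSquare.zero
    obtain ⟨s, hs⟩ : IsSquare (d / ε) := by
      have h1 : quadraticChar (ZMod p) (d / ε) * quadraticChar (ZMod p) ε =
          quadraticChar (ZMod p) d := by
        rw [← map_mul, div_mul_cancel₀ _ hε0]
      rw [quadraticChar_neg_one_iff_not_isSquare.2 hε,
        quadraticChar_neg_one_iff_not_isSquare.2 hsq] at h1
      rw [← quadraticChar_one_iff_isSquare (div_ne_zero hd hε0)]
      linarith
    refine ⟨!![0, s; -s * ε, 0], Or.inr ⟨rfl, rfl⟩, Or.inr ⟨by simp, by simp⟩, ?_⟩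
    rw [div_eq_iff hε0] at hs
    rw [Matrix.det_fin_two, hs]
    simp [mul_assoc]

/-- The map `J_{ns+} → J_{s+}` given by the double coset `Γ_{s+} · 1 · Γ_{ns+}` commutes with the
Hecke operators `T_ℓ` for all primes `ℓ` not dividing `N = p ^ 2 * M`; moreover `T_ℓ` descends to
the quotient `J_{s+}^{p-new}`, and the map `J_{ns+} → J_{s+}^{p-new}` commutes with `T_ℓ`. -/
theorem proposition4p1 (p : ℕ) [Fact p.Prime] (hp : p ≠ 2) (ε : ZMod p) (hε : ¬ IsSquare ε)
    (D : ShimuraDatum p) (M : ℕ) (hM : D.HasReducedDiscriminant M)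
    (ℓ : ℕ) (hℓ : ℓ.Prime) (hℓN : ¬ ℓ ∣ p ^ 2 * M) :
    (D.doubleCosetMap ε).comp (D.T (cartanNsPlus p ε) ℓ hℓ.pos) =
        (D.T (cartanSPlus p) ℓ hℓ.pos).comp (D.doubleCosetMap ε) ∧
      ∃ h : D.pOld ≤ D.pOld.comap (D.T (cartanSPlus p) ℓ hℓ.pos),
        (D.doubleCosetMapNew ε).comp (D.T (cartanNsPlus p ε) ℓ hℓ.pos) =
          (QuotientAddGroup.map D.pOld D.pOld (D.T (cartanSPlus p) ℓ hℓ.pos) h).comp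
            (D.doubleCosetMapNew ε) := by
  have hpp : p.Prime := Fact.out
  have hpl : ¬ p ∣ ℓ := fun h => hℓN <| by
    rw [(Nat.prime_dvd_prime_iff_eq hpp hℓ).1 h]
    exact (dvd_pow_self ℓ two_ne_zero).mul_right M
  have hl0 : (ℓ : ZMod p) ≠ 0 := by rwa [Ne, ZMod.natCast_eq_zero_iff]
  have hdiag : !![1, 0; 0, (ℓ : ZMod p)] ∈ cartanSPlus p := Or.inl ⟨rfl, rfl⟩
  have hdet : (!![1, 0; 0, (ℓ : ZMod p)]).det = ℓ := by simp [Matrix.det_fin_two]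
  have hcomm := D.doubleCoset_comm_T hℓ.pos hp hε hpl
    (exists_mem_cartanSPlus_mem_cartanNsPlus hε hl0)
  have hupper := D.doubleCoset_comm_T (U := cartanSPlus p) (U' := upperTriangular p) hℓ.pos hp hε hpl
    ⟨_, hdiag, rfl, hdet⟩
  have hlower := D.doubleCoset_comm_T (U := cartanSPlus p) (U' := lowerTriangular p) hℓ.pos hp hε hpl
    ⟨_, hdiag, rfl, hdet⟩
  have hold : D.pOld ≤ D.pOld.comap (D.T (cartanSPlus p) ℓ hℓ.pos) := by
    refine sup_le ?_ ?_
    · rintro _ ⟨x, rfl⟩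
      exact AddSubgroup.mem_sup_left ⟨_, DFunLike.congr_fun hupper x⟩
    · rintro _ ⟨x, rfl⟩
      exact AddSubgroup.mem_sup_right ⟨_, DFunLike.congr_fun hlower x⟩
  exact ⟨hcomm, hold, AddMonoidHom.ext fun x =>
    congrArg (QuotientAddGroup.mk (s := D.pOld)) (DFunLike.congr_fun hcomm x)⟩
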